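/- Let $n\in\mathbb N$, $\gamma>1$, $\kappa,\lambda\in\mathbb R$, $\mu:=\lambda-1$, and assume (A) $0<\mu<\frac{\kappa+n}{2}$ and (B) $\mu<\frac n2(\gamma-1)$. Put $$V_*=\tfrac{\kappa-2\mu}{n\gamma},\quad W_*=1+V_*,\quad \alpha=\tfrac1\gamma\big[\mu+\tfrac\kappa2(\gamma-1)\big],\quad q=\tfrac{2\gamma\alpha}{\kappa+n},$$ $$k_1=1+\tfrac{(n-1)(\gamma-1)}2,\quad k_2=\tfrac{(n-1)(\gamma-1)+(\gamma-3)\mu}{2},\quad k_3=\tfrac{(\gamma-1)\mu}{2},$$ $$D=(1+V)^2-C^2,\qquad G=nC^2(V-V_*)-V(1+V)(\lambda+V),$$ $$F=C\big[C^2\big(1+\tfrac{\alpha}{1+V}\big)-k_1(1+V)^2+k_2(1+V)-k_3\big].$$ With $W=1+V$, $Z=C^2$, the reduced similarity ODE $\frac{dC}{dV}=\frac FG$ becomes $$\frac{dZ}{dW}=\frac{2Z[\alpha Z-k_3W+W(Z-k_1W^2+k_2W)]}{W[\mu W-nW_*Z+W(nZ-W^2-(\mu-1)W)]}.\qquad(*)$$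 (1) The number $\sigma=\frac{\gamma\mu}{\kappa+n}$ is positive, and $(*)$ has a unique trajectory $\Gamma$ which approaches $(W,Z)=(0,0)$ as $W\downarrow0$ with slope $\sigma$: for some $\delta>0$ there is a solution $Z=\Gamma(W)>0$ of $(*)$ on $(0,\delta)$ (the denominator being non-zero along it) with $\Gamma(W)\to0$ and $\Gamma(W)/W\to\sigma$ as $W\downarrow0$, and every solution $z$ of $(*)$ on some $(0,\delta')$ with non-zero denominator, $z(W)\to 0$ and $z(W)/W\to\sigma$ as $W\downarrow 0$ coincides with $\Gamma$ on $(0,\min(\delta,\delta'))$. (2) The number $\delta$ can moreover be chosen so that $\Gamma$ on $(0,\delta)$ generates Euler flows whose pressure vanishes at the vacuum interface, as follows. For $K>0$ and $x_0<x_2\le0$, call functions $(V,C,R)$ on $(x_0,x_2)$ *profiles along $\Gamma$* if $C,R>0$, $0<1+V<\delta$, $D(V,C)\neq0$, $C^2=\Gamma(1+V)$, $$V'=-\frac1{\lambda x}\frac{G(V,C)}{D(V,C)},\qquad C'=-\frac1{\lambda x}\frac{F(V,C)}{D(V,C)},\qquad [R\,|1+V|]^qR^{1-\gamma}\Big(\frac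 Cx\Big)^2\equiv K,$$ and $(V,C)\to(-1,0)$ as $x\downarrow x_0$. Then: (a) for all $K>0$, $x_1<0$ and $w\in(0,\delta)$ there are a finite $x_0<x_1$, some $x_2>x_1$, and profiles along $\Gamma$ on $(x_0,x_2)$ with constant $K$ and $1+V(x_1)=w$; (b) for any profiles along $\Gamma$, with $x=t/r^\lambda$, the functions $$\rho=r^\kappa R(x),\qquad u=-\frac{r^{1-\lambda}}{\lambda}\frac{V(x)}x,\qquad c=-\frac{r^{1-\lambda}}{\lambda}\frac{C(x)}x$$ form a $C^1$ solution of the radial Euler system $$\rho_t+u\rho_r+\rho\big(u_r+\tfrac{(n-1)u}r\big)=0,\quad u_t+uu_r+\tfrac1{\gamma\rho}(\rho c^2)_r=0,\quad c_t+uc_r+\tfrac{\gamma-1}2c\big(u_r+\tfrac{(n-1)u}r\big)=0$$ on $\{t<0,\ r>0,\ x_0<t/r^\lambda<x_2\}$, and for each $t<0$ the pressure $p=\rho c^2/\gamma$ satisfies $p(t,r)\to0$ as $r\downarrow r_0(t):=(t/x_0)^{1/\lambda}$, the vacuum interface. -/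

import Mathlib

open Set Filter Topology

noncomputable section

namespace Cavity

/-! Parameters: space dimension `n`, adiabatic index `γ`, similarity exponents `κ` and `lam`;
throughout, `μ = lam - 1`. -/

def Vstar (n : ℕ) (γ κ lam : ℝ) : ℝ := (κ - 2 * (lam - 1)) / (n * γ)

def Wstar (n : ℕ) (γ κ lam : ℝ) : ℝ := 1 + Vstar n γ κ lam

def alpha (γ κ lam : ℝ) : ℝ := (1 / γ) * ((lam - 1) + κ / 2 * (γ - 1))

def k1 (n : ℕ) (γ : ℝ) : ℝ := 1 + ((n : ℝ) - 1) * (γ - 1) / 2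

def k2 (n : ℕ) (γ lam : ℝ) : ℝ := (((n : ℝ) - 1) * (γ - 1) + (γ - 3) * (lam - 1)) / 2

def k3 (γ lam : ℝ) : ℝ := (γ - 1) * (lam - 1) / 2

/-- The exponent `q` in the adiabatic integral. -/
def qExp (n : ℕ) (γ κ lam : ℝ) : ℝ := 2 * γ * alpha γ κ lam / (κ + n)

/-! ### The similarity ODEs for `V` and `C` -/

def D (V C : ℝ) : ℝ := (1 + V) ^ 2 - C ^ 2

def G (n : ℕ) (γ κ lam V C : ℝ) : ℝ :=
  n * C ^ 2 * (V - Vstar n γ κ lam) - V * (1 + V) * (lam + V)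

def F (n : ℕ) (γ κ lam V C : ℝ) : ℝ :=
  C * (C ^ 2 * (1 + alpha γ κ lam / (1 + V)) - k1 n γ * (1 + V) ^ 2
    + k2 n γ lam * (1 + V) - k3 γ lam)

/-- `(V, C)` solves `V' = -G / (lam x D)`, `C' = -F / (lam x D)` on the interval `(a, b)`,
off the sonic lines `D = 0`. -/
def IsSimilaritySolution (n : ℕ) (γ κ lam : ℝ) (V C : ℝ → ℝ) (a b : ℝ) : Prop :=
  ∀ x ∈ Ioo a b, D (V x) (C x) ≠ 0 ∧
    HasDerivAt V (-(1 / (lam * x)) * (G n γ κ lam (V x) (C x) / D (V x) (C x))) x ∧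
    HasDerivAt C (-(1 / (lam * x)) * (F n γ κ lam (V x) (C x) / D (V x) (C x))) x

/-! ### The reduced similarity ODE in the variables `W = 1 + V`, `Z = C ^ 2` -/

/-- Numerator of the right-hand side of the ODE for `dZ/dW`. -/
def numZW (n : ℕ) (γ κ lam W Z : ℝ) : ℝ :=
  2 * Z * (alpha γ κ lam * Z - k3 γ lam * W + W * (Z - k1 n γ * W ^ 2 + k2 n γ lam * W))

/-- Denominator of the right-hand side of the ODE for `dZ/dW`. -/
def denZW (n : ℕ) (γ κ lam W Z : ℝ) : ℝ :=
  W * ((lam - 1) * W - n * Wstar n γ κ lam * Z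
    + W * (n * Z - W ^ 2 - ((lam - 1) - 1) * W))

/-- The graph of `z` over `(0, δ)` is a trajectory of `dZ/dW = numZW / denZW` which approaches the
critical point `(0, 0)` as `W ↓ 0`, with slope `s` there. -/
structure IsTrajectoryWithSlope (n : ℕ) (γ κ lam s : ℝ) (z : ℝ → ℝ) (δ : ℝ) : Prop where
  pos : 0 < δ
  den_ne : ∀ W ∈ Ioo 0 δ, denZW n γ κ lam W (z W) ≠ 0
  ode : ∀ W ∈ Ioo 0 δ, HasDerivAt z (numZW n γ κ lam W (z W) / denZW n γ κ lam W (z W)) W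
  tendsto_zero : Tendsto z (𝓝[>] 0) (𝓝 0)
  slope : Tendsto (fun W => z W / W) (𝓝[>] 0) (𝓝 s)

/-! ### The Euler flow generated by a trajectory -/

/-- `(V, C, R)` are similarity profiles on `(x₀, x₂)` generated by the trajectory `Z = z W`,
`0 < W < δ`: `(V, C)` solves the similarity ODEs, moves along the trajectory, and reaches the
critical point `(V, C) = (-1, 0)` at `x = x₀`; the density profile `R > 0` is
given by the adiabatic integral with constant `K > 0`. -/
structure IsProfileAlong (n : ℕ) (γ κ lam : ℝ) (z : ℝ → ℝ) (δ : ℝ) (V C R : ℝ → ℝ)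
    (K x₀ x₂ : ℝ) : Prop where
  lt : x₀ < x₂
  nonpos : x₂ ≤ 0
  sol : IsSimilaritySolution n γ κ lam V C x₀ x₂
  C_pos : ∀ x ∈ Ioo x₀ x₂, 0 < C x
  mem : ∀ x ∈ Ioo x₀ x₂, 1 + V x ∈ Ioo 0 δ
  along : ∀ x ∈ Ioo x₀ x₂, C x ^ 2 = z (1 + V x)
  V_start : Tendsto V (𝓝[>] x₀) (𝓝 (-1))
  C_start : Tendsto C (𝓝[>] x₀) (𝓝 0)
  K_pos : 0 < K
  R_pos : ∀ x ∈ Ioo x₀ x₂, 0 < R x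
  adiabatic : ∀ x ∈ Ioo x₀ x₂,
    (R x * |1 + V x|) ^ qExp n γ κ lam * R x ^ (1 - γ) * (C x / x) ^ 2 = K

/-- Density of the self-similar flow with density profile `R`. -/
def density (κ lam : ℝ) (R : ℝ → ℝ) (t r : ℝ) : ℝ := r ^ κ * R (t / r ^ lam)

/-- `-(r ^ (1 - lam) / lam) * (Φ x / x)` at `x = t / r ^ lam`: the radial velocity for `Φ = V`,
the sound speed for `Φ = C`. -/
def speed (lam : ℝ) (Φ : ℝ → ℝ) (t r : ℝ) : ℝ :=
  -(r ^ (1 - lam) / lam) * (Φ (t / r ^ lam) / (t / r ^ lam))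

/-- Pressure of an ideal polytropic gas, from `c ^ 2 = γ p / ρ`. -/
def pressure (γ : ℝ) (ρ c : ℝ → ℝ → ℝ) (t r : ℝ) : ℝ := ρ t r * c t r ^ 2 / γ

/-- Classical solutions of the radial Euler system in `(t, r)`, on a set `Ω`. -/
structure IsRadialEulerFlow (n : ℕ) (γ : ℝ) (ρ u c : ℝ → ℝ → ℝ) (Ω : Set (ℝ × ℝ)) : Prop where
  contDiff_density : ContDiffOn ℝ 1 (fun y : ℝ × ℝ => ρ y.1 y.2) Ω
  contDiff_velocity : ContDiffOn ℝ 1 (fun y : ℝ × ℝ => u y.1 y.2) Ω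
  contDiff_sound : ContDiffOn ℝ 1 (fun y : ℝ × ℝ => c y.1 y.2) Ω
  mass : ∀ t r : ℝ, (t, r) ∈ Ω →
    deriv (fun τ => ρ τ r) t + u t r * deriv (fun y => ρ t y) r
      + ρ t r * (deriv (fun y => u t y) r + ((n : ℝ) - 1) * u t r / r) = 0
  momentum : ∀ t r : ℝ, (t, r) ∈ Ω →
    deriv (fun τ => u τ r) t + u t r * deriv (fun y => u t y) r
      + 1 / (γ * ρ t r) * deriv (fun y => ρ t y * c t y ^ 2) r = 0
  energy : ∀ t r : ℝ, (t, r) ∈ Ω →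
    deriv (fun τ => c τ r) t + u t r * deriv (fun y => c t y) r
      + (γ - 1) / 2 * c t r * (deriv (fun y => u t y) r + ((n : ℝ) - 1) * u t r / r) = 0

/-- The part of space-time, prior to collapse, where `x₀ < t / r ^ lam < x₂`. -/
def fluidRegion (lam x₀ x₂ : ℝ) : Set (ℝ × ℝ) :=
  {y | y.1 < 0 ∧ 0 < y.2 ∧ y.1 / y.2 ^ lam ∈ Ioo x₀ x₂}

/-- Radius at time `t < 0` of the vacuum interface `t / r ^ lam = x₀`. -/
def interfaceRadius (lam x₀ t : ℝ) : ℝ := (t / x₀) ^ (1 / lam)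

end Cavity

end

/-! The origin is a degenerate critical point of (*). The substitution Z = W y blows it up: a factor
W² cancels from numerator and denominator, and (*) becomes W y' = g(W, y) with g = `slopeField`. On
W = 0 the numerator of g is y((κ+n)y − γμ), with σ as nonzero root. By (B) the remaining denominator
is negative at (0, σ), so ∂g/∂y(0, σ) = −a with a > 0. Perturbations of y = σ then behave like
W^(−a), and a single solution can tend to σ as W ↓ 0. Existence is a contraction argument for the
integrated equation; uniqueness near 0 holds because the squared difference of two solutions is
nonincreasing in W (`exists_unique_solution_singular_ode`). A Gronwall argument extends the equality
to the whole common interval.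

Along the trajectory both G and D carry a factor W, and it cancels in G/D. In the variable log(x₁/x)
the equation for W is therefore autonomous and regular down to W = 0, with nonzero speed there
because y(0) = σ > 0. So the critical point is reached at a finite x₀ (`exists_profile`).

Inserting the similarity ansatz reduces the Euler system to three profile equations. Those for
energy and momentum are polynomial identities in F, G, D; the mass equation is the logarithmic
derivative of the adiabatic integral. Finally (B) says exactly that q + 1 − γ < 0, and solving the
adiabatic integral for R C² then yields a positive power of a quantity of order W^γ, so the pressure
vanishes at the interface. -/

namespace Cavity

/-! ### Scalar ODEs with a singular point at W = 0 -/

/-- A bounded continuous fixed point of `e ↦ ∫₀¹ M (v θ) (e (v θ)) dθ`, when `M` is bounded and a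
contraction in its second argument. -/
theorem exists_continuous_eq_integral_average {M : ℝ → ℝ → ℝ} {L B : ℝ}
    (hM : Continuous (Function.uncurry M)) (hB : ∀ v e, |M v e| ≤ B) (hL0 : 0 ≤ L) (hL : L < 1)
    (hLip : ∀ v e e', |M v e - M v e'| ≤ L * |e - e'|) :
    ∃ e : ℝ → ℝ, Continuous e ∧ ∀ v, e v = ∫ θ in (0 : ℝ)..1, M (v * θ) (e (v * θ)) := by
  have hcont : ∀ e : ℝ → ℝ, Continuous e →
      Continuous (Function.uncurry fun v θ : ℝ => M (v * θ) (e (v * θ))) := by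
    intro e he
    have : Continuous fun p : ℝ × ℝ => (p.1 * p.2, e (p.1 * p.2)) := by fun_prop
    exact hM.comp this
  have hcont' : ∀ e : ℝ → ℝ, Continuous e → ∀ v : ℝ,
      Continuous fun θ : ℝ => M (v * θ) (e (v * θ)) := fun e he v =>
    (hcont e he).comp (Continuous.prodMk_right v)
  lift L to NNReal using hL0
  let T : BoundedContinuousFunction ℝ ℝ → BoundedContinuousFunction ℝ ℝ := fun e =>
    BoundedContinuousFunction.ofNormedAddCommGroup
      (fun v => ∫ θ in (0 : ℝ)..1, M (v * θ) (e (v * θ)))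
      (intervalIntegral.continuous_parametric_intervalIntegral_of_continuous'
        (hcont e e.continuous) 0 1) B
      (fun v => by
        have := intervalIntegral.norm_integral_le_of_norm_le_const (a := (0 : ℝ)) (b := 1)
          (f := fun θ => M (v * θ) (e (v * θ))) (C := B) fun θ _ => hB _ _
        simpa using this)
  have hT : ContractingWith L T := by
    refine ⟨by exact_mod_cast hL, LipschitzWith.of_dist_le_mul fun e e' => ?_⟩
    rw [BoundedContinuousFunction.dist_le (by positivity)]
    intro v
    change |(∫ θ in (0 : ℝ)..1, M (v * θ) (e (v * θ))) -
      ∫ θ in (0 : ℝ)..1, M (v * θ) (e' (v * θ))| ≤ L * dist e e'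
    rw [← intervalIntegral.integral_sub ((hcont' e e.continuous v).intervalIntegrable _ _)
      ((hcont' e' e'.continuous v).intervalIntegrable _ _)]
    have := intervalIntegral.norm_integral_le_of_norm_le_const (a := (0 : ℝ)) (b := 1)
      (f := fun θ => M (v * θ) (e (v * θ)) - M (v * θ) (e' (v * θ))) (C := L * dist e e')
      fun θ _ => (hLip _ _ _).trans
        (mul_le_mul_of_nonneg_left (BoundedContinuousFunction.dist_coe_le_dist (f := e) (g := e') (v * θ)) L.coe_nonneg)
    simpa using this
  obtain ⟨e, h⟩ : ∃ e, T e = e := ⟨_, hT.fixedPoint_isFixedPt⟩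
  refine ⟨e, e.continuous, fun v => ?_⟩
  exact (congrArg (fun f : BoundedContinuousFunction ℝ ℝ => f v) h).symm

/-- The equation says (v e)' = M(v, e), hence e is the mean of M(s, e s) over [0, v]. Rescaling to s
= vθ gives the fixed-point equation. -/
theorem exists_solution_singular_ode_one {M : ℝ → ℝ → ℝ} {L B : ℝ}
    (hM : Continuous (Function.uncurry M)) (hB : ∀ v e, |M v e| ≤ B) (hL0 : 0 ≤ L) (hL : L < 1)
    (hLip : ∀ v e e', |M v e - M v e'| ≤ L * |e - e'|) (h0 : M 0 0 = 0) :
    ∃ e : ℝ → ℝ, Continuous e ∧ e 0 = 0 ∧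
      ∀ v > 0, HasDerivAt e ((-e v + M v (e v)) / v) v := by
  obtain ⟨e, he, hfix⟩ := exists_continuous_eq_integral_average hM hB hL0 hL hLip
  refine ⟨e, he, ?_, fun v hv => ?_⟩
  · have h1 : e 0 = M 0 (e 0) := by simpa using hfix 0
    have h2 := hLip 0 (e 0) 0
    rw [h0, ← h1, sub_zero] at h2
    have h3 : |e 0| ≤ 0 := by nlinarith [abs_nonneg (e 0)]
    exact abs_nonpos_iff.1 h3
  · have hm : Continuous fun s => M s (e s) :=
      hM.comp (continuous_id.prodMk he)
    have hform : ∀ w : ℝ, w ≠ 0 → e w = w⁻¹ * ∫ s in (0 : ℝ)..w, M s (e s) := by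
      intro w hw
      have := intervalIntegral.integral_comp_mul_left (a := 0) (b := 1)
        (fun s => M s (e s)) hw
      rw [hfix w, this]
      simp
    have hd : HasDerivAt (fun w => w⁻¹ * ∫ s in (0 : ℝ)..w, M s (e s))
        (-(v ^ 2)⁻¹ * (∫ s in (0 : ℝ)..v, M s (e s)) + v⁻¹ * M v (e v)) v :=
      (hasDerivAt_inv hv.ne').mul (hm.integral_hasStrictDerivAt 0 v).hasDerivAt
    have heq : e =ᶠ[𝓝 v] fun w => w⁻¹ * ∫ s in (0 : ℝ)..w, M s (e s) := by
      filter_upwards [eventually_ne_nhds hv.ne'] with w hw using hform w hw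
    refine (hd.congr_of_eventuallyEq heq).congr_deriv ?_
    rw [hform v hv.ne']
    field_simp

/-- `W e' = -a e + N (W, e)` with `a > 0` has a continuous solution starting at `e 0 = 0`. -/
theorem exists_solution_singular_ode {N : ℝ → ℝ → ℝ} {a L B : ℝ} (ha : 0 < a)
    (hN : Continuous (Function.uncurry N)) (hB : ∀ v e, |N v e| ≤ B) (hL0 : 0 ≤ L) (hL : L < a)
    (hLip : ∀ v e e', |N v e - N v e'| ≤ L * |e - e'|) (h0 : N 0 0 = 0) :
    ∃ e : ℝ → ℝ, Continuous e ∧ e 0 = 0 ∧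
      ∀ W > 0, HasDerivAt e ((-a * e W + N W (e W)) / W) W := by
  -- The substitution v = W^a turns W d/dW into a · v d/dv; dividing by a reduces to the case a = 1,
  -- with Lipschitz constant L / a < 1.
  have hrpow : Continuous fun v : ℝ => v ^ a⁻¹ := Real.continuous_rpow_const (inv_pos.2 ha).le
  obtain ⟨E, hE, hE0, hEd⟩ := exists_solution_singular_ode_one
    (M := fun v e => N (v ^ a⁻¹) e / a) (L := L / a) (B := B / a)
    ((hN.comp (((hrpow.comp continuous_fst).prodMk continuous_snd) :
      Continuous fun p : ℝ × ℝ => (p.1 ^ a⁻¹, p.2))).div_const a)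
    (fun v e => by rw [abs_div, abs_of_pos ha]; gcongr; exact hB _ _)
    (by positivity) (by rwa [div_lt_one ha])
    (fun v e e' => by
      rw [← sub_div, abs_div, abs_of_pos ha, div_mul_eq_mul_div]; gcongr; exact hLip _ _ _)
    (by simp [Real.zero_rpow (inv_pos.2 ha).ne', h0])
  refine ⟨fun W => E (W ^ a), hE.comp (Real.continuous_rpow_const ha.le), ?_, fun W hW => ?_⟩
  · simp [Real.zero_rpow ha.ne', hE0]
  · have h1 := (hEd (W ^ a) (Real.rpow_pos_of_pos hW a)).comp W
      (Real.hasDerivAt_rpow_const (p := a) (Or.inl hW.ne'))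
    refine h1.congr_deriv ?_
    rw [← Real.rpow_mul hW.le, mul_inv_cancel₀ ha.ne', Real.rpow_one, Real.rpow_sub_one hW.ne']
    have := (Real.rpow_pos_of_pos hW a).ne'
    field_simp

/-- Difference estimate for a function whose partial derivative in `y` is `-a`. -/
theorem exists_box_lipschitz {g : ℝ × ℝ → ℝ} {σ a ε : ℝ} (hg : ContDiffAt ℝ 1 g (0, σ))
    (hd : HasDerivAt (fun y => g (0, y)) (-a) σ) (hε : 0 < ε) :
    ∃ r > 0, ContinuousOn g (Icc (-r) r ×ˢ Icc (σ - r) (σ + r)) ∧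
      ∀ W ∈ Icc (-r) r, ∀ y ∈ Icc (σ - r) (σ + r), ∀ y' ∈ Icc (σ - r) (σ + r),
        |g (W, y) - g (W, y') + a * (y - y')| ≤ ε * |y - y'| := by
  -- Strict differentiability is what bounds differences between two arbitrary points of the box; on
  -- pairs with equal W only the y-derivative −a remains.
  have hs := hg.hasStrictFDerivAt one_ne_zero
  have hder : ∀ t : ℝ, fderiv ℝ g (0, σ) (0, t) = -a * t := by
    intro t
    have h1 : HasDerivAt (fun y => g (0, y)) (fderiv ℝ g (0, σ) (0, 1)) σ := by
      have hc : HasDerivAt (fun y : ℝ => ((0 : ℝ), y)) (0, 1) σ :=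
        (hasDerivAt_const σ (0 : ℝ)).prodMk (hasDerivAt_id σ)
      exact hs.hasFDerivAt.comp_hasDerivAt σ hc
    have h2 := h1.unique hd
    have : ((0 : ℝ), t) = t • ((0 : ℝ), (1 : ℝ)) := by simp
    rw [this, map_smul, h2]
    simp [mul_comm]
  have h1 := hs.isLittleO.def hε
  have h2 : ∀ᶠ p : ℝ × ℝ in 𝓝 (0, σ), ContinuousAt g p := by
    filter_upwards [hg.eventually (by simp)] with p hp using hp.continuousAt
  rw [nhds_prod_eq, Filter.eventually_prod_self_iff'] at h1
  obtain ⟨s, hs1, hs2⟩ := h1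
  obtain ⟨r, hr, hball⟩ := Metric.nhds_basis_closedBall.mem_iff.1 (Filter.inter_mem hs1 h2)
  have hbox : Icc (-r) r ×ˢ Icc (σ - r) (σ + r) ⊆ Metric.closedBall ((0 : ℝ), σ) r := by
    rw [← closedBall_prod_same, Real.closedBall_eq_Icc, Real.closedBall_eq_Icc]
    simp
  refine ⟨r, hr, fun p hp => (hball (hbox hp)).2.continuousWithinAt, ?_⟩
  intro W hW y hy y' hy'
  have := hs2 (W, y) (hball (hbox ⟨hW, hy⟩)).1 (W, y') (hball (hbox ⟨hW, hy'⟩)).1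
  simpa [hder, Prod.norm_def] using this

/-- A first-order ODE `W y' = g (W, y)` with a saddle-type singular point at `(0, σ)` has a
solution through that point, and it is unique. -/
theorem exists_unique_solution_singular_ode {g : ℝ × ℝ → ℝ} {σ a : ℝ} (ha : 0 < a)
    (hg : ContDiffAt ℝ 1 g (0, σ)) (h0 : g (0, σ) = 0)
    (hd : HasDerivAt (fun y => g (0, y)) (-a) σ) :
    ∃ r > 0, ∃ y : ℝ → ℝ, Continuous y ∧ y 0 = σ ∧
      (∀ W ∈ Ioo 0 r, HasDerivAt y (g (W, y W) / W) W) ∧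
      ∀ (y' : ℝ → ℝ) (δ : ℝ), 0 < δ → Tendsto y' (𝓝[>] 0) (𝓝 σ) →
        (∀ W ∈ Ioo 0 δ, HasDerivAt y' (g (W, y' W) / W) W) →
          ∃ η > 0, EqOn y' y (Ioo 0 η) := by
  obtain ⟨r, hr, hcont, hlip⟩ := exists_box_lipschitz hg hd (half_pos ha)
  -- Clamping both arguments to the box makes the nonlinearity globally bounded and a/2-Lipschitz.
  -- The solution starts at e = 0, so near W = 0 the clamp is inactive.
  let π : ℝ → ℝ := fun t => max (-r) (min r t)
  have hπ : Continuous π := by fun_prop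
  have hπm : ∀ t, π t ∈ Icc (-r) r := fun t => ⟨le_max_left _ _, by
    simp only [π]; exact max_le (by linarith) (min_le_left _ _)⟩
  have hπid : ∀ t ∈ Icc (-r) r, π t = t := by
    intro t ht
    simp only [π]
    rw [min_eq_right ht.2, max_eq_right ht.1]
  have hπlip : ∀ s t, |π s - π t| ≤ |s - t| := by
    intro s t
    simp only [π]
    rw [max_comm (-r), max_comm (-r), min_comm r, min_comm r]
    exact (abs_max_sub_max_le_abs _ _ _).trans (abs_min_sub_min_le_max _ _ _ _ |>.trans (by simp))
  have hπσ : ∀ t, σ + π t ∈ Icc (σ - r) (σ + r) := fun t => by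
    have := hπm t; constructor <;> linarith [this.1, this.2]
  let N : ℝ → ℝ → ℝ := fun W e => g (π W, σ + π e) + a * π e
  have hNc : Continuous (Function.uncurry N) := by
    have h1 : Continuous fun p : ℝ × ℝ => (π p.1, σ + π p.2) := by fun_prop
    have h2 : Continuous fun p : ℝ × ℝ => g (π p.1, σ + π p.2) :=
      hcont.comp_continuous h1 fun p => ⟨hπm _, hπσ _⟩
    exact h2.add (by fun_prop)
  have hNb : ∃ B, ∀ W e, |N W e| ≤ B := by
    obtain ⟨B, hB⟩ := ((isCompact_Icc (a := -r) (b := r)).prod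
      (isCompact_Icc (a := σ - r) (b := σ + r))).exists_bound_of_continuousOn hcont
    refine ⟨B + a * r, fun W e => (abs_add_le _ _).trans (add_le_add (hB _ ⟨hπm _, hπσ _⟩) ?_)⟩
    rw [abs_mul, abs_of_pos ha]
    gcongr
    exact abs_le.2 (hπm e)
  obtain ⟨B, hB⟩ := hNb
  obtain ⟨e, he, he0, hed⟩ := exists_solution_singular_ode ha hNc hB (half_pos ha).le (half_lt_self ha)
    (fun W e e' => by
      have h1 := hlip _ (hπm W) _ (hπσ e) _ (hπσ e')
      have h2 := hπlip e e'
      calc |N W e - N W e'| = |g (π W, σ + π e) - g (π W, σ + π e')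
            + a * ((σ + π e) - (σ + π e'))| := by simp only [N]; congr 1; ring
        _ ≤ a / 2 * |π e - π e'| := by simpa using h1
        _ ≤ a / 2 * |e - e'| := by gcongr)
    (by
      have h3 : π 0 = 0 := hπid 0 ⟨by linarith, hr.le⟩
      simp [N, h3, h0])
  have hsmall : ∀ᶠ W in 𝓝 0, e W ∈ Icc (-r) r := by
    apply he.continuousAt
    rw [he0]
    exact Icc_mem_nhds (by linarith) hr
  obtain ⟨ρ, hρ, hρs⟩ := Metric.eventually_nhds_iff.1 hsmall
  have hy : ∀ W ∈ Ioo 0 (min ρ r),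
      HasDerivAt (fun W => σ + e W) (g (W, σ + e W) / W) W := by
    intro W hW
    have h1 : W < ρ := hW.2.trans_le (min_le_left _ _)
    have h2 : W < r := hW.2.trans_le (min_le_right _ _)
    have h3 := (hed W hW.1).const_add σ
    refine h3.congr_deriv ?_
    have h4 := hπid (e W) (hρs (by rw [Real.dist_eq, sub_zero, abs_of_pos hW.1]; exact h1))
    have h5 := hπid W ⟨by linarith [hW.1], h2.le⟩
    dsimp only [N]
    rw [h4, h5]
    ring
  refine ⟨min ρ r, lt_min hρ hr, fun W => σ + e W, by fun_prop, by simp [he0], hy, ?_⟩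
  intro y' δ hδ hy' hyd
  have hsm' : ∀ᶠ W in 𝓝[>] 0, y' W ∈ Icc (σ - r) (σ + r) :=
    hy' (Icc_mem_nhds (by linarith) (by linarith))
  obtain ⟨η, hη, hη'⟩ := mem_nhdsGT_iff_exists_Ioo_subset.1 hsm'
  have hη0 : (0 : ℝ) < η := hη
  set m := min (min ρ r) (min δ η) with hm
  have hm0 : 0 < m := lt_min (lt_min hρ hr) (lt_min hδ hη0)
  have hmρ : m ≤ min ρ r := min_le_left _ _
  have hmδ : m ≤ δ := (min_le_right _ _).trans (min_le_left _ _)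
  have hmη : m ≤ η := (min_le_right _ _).trans (min_le_right _ _)
  refine ⟨m, hm0, ?_⟩
  -- With d the difference of the solutions, the box estimate gives W d d' ≤ −(a/2) d². So d² is
  -- nonincreasing, and its limit at 0 is 0, which forces d = 0.
  let f : ℝ → ℝ := fun W => (y' W - (σ + e W)) ^ 2
  have hfd : ∀ W ∈ Ioo 0 m, HasDerivAt f (2 * (y' W - (σ + e W)) *
      (g (W, y' W) / W - g (W, σ + e W) / W)) W := by
    intro W hW
    have h1 := ((hyd W ⟨hW.1, hW.2.trans_le hmδ⟩).sub (hy W ⟨hW.1, hW.2.trans_le hmρ⟩)).pow 2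
    exact h1.congr_deriv (by simp)
  have hanti : AntitoneOn f (Ioo 0 m) := by
    apply antitoneOn_of_deriv_nonpos (convex_Ioo 0 m)
    · exact fun W hW => (hfd W hW).continuousAt.continuousWithinAt
    · rw [interior_Ioo]
      exact fun W hW => (hfd W hW).differentiableAt.differentiableWithinAt
    · rw [interior_Ioo]
      intro W hW
      rw [(hfd W hW).deriv]
      have hWr : W ≤ r := (hW.2.trans_le hmρ).le.trans (min_le_right _ _)
      have hWρ : W < ρ := hW.2.trans_le (hmρ.trans (min_le_left _ _))
      have he' := hρs (y := W) (by rw [Real.dist_eq, sub_zero, abs_of_pos hW.1]; exact hWρ)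
      have hl := hlip W ⟨by linarith [hW.1], hWr⟩ (y' W) (hη' ⟨hW.1, hW.2.trans_le hmη⟩)
        (σ + e W) ⟨by linarith [he'.1], by linarith [he'.2]⟩
      set d := y' W - (σ + e W)
      set G := g (W, y' W) - g (W, σ + e W)
      have hdG : d * (G + a * d) ≤ a / 2 * d ^ 2 := by
        calc d * (G + a * d) ≤ |d * (G + a * d)| := le_abs_self _
          _ = |d| * |G + a * d| := abs_mul _ _
          _ ≤ |d| * (a / 2 * |d|) := by gcongr
          _ = a / 2 * |d| ^ 2 := by ring
          _ = a / 2 * d ^ 2 := by rw [sq_abs]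
      have hdG' : d * G ≤ 0 := by nlinarith [sq_nonneg d]
      have : 2 * d * (g (W, y' W) / W - g (W, σ + e W) / W) = 2 * (d * G) / W := by
        simp only [G]; ring
      rw [this]
      exact div_nonpos_of_nonpos_of_nonneg (by linarith) hW.1.le
  have hlim : Tendsto f (𝓝[>] 0) (𝓝 0) := by
    have h1 : Tendsto (fun W => σ + e W) (𝓝[>] 0) (𝓝 σ) := by
      have : Continuous fun W => σ + e W := by fun_prop
      have h2 := this.tendsto 0
      simp only [he0, add_zero] at h2
      exact h2.mono_left nhdsWithin_le_nhds
    simpa using (hy'.sub h1).pow 2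
  intro W hW
  have hle : f W ≤ 0 := by
    refine ge_of_tendsto hlim ?_
    filter_upwards [Ioo_mem_nhdsGT hW.1] with s hs
    exact hanti ⟨hs.1, hs.2.trans hW.2⟩ hW hs.2.le
  have : y' W - (σ + e W) = 0 := by
    have := le_antisymm hle (sq_nonneg _)
    exact pow_eq_zero_iff (two_ne_zero) |>.1 this
  simpa [sub_eq_zero] using this

/-- A solution of a homogeneous linear ODE that vanishes near the left end vanishes. -/
theorem eq_zero_of_linear_ode {d b : ℝ → ℝ} {m η : ℝ} (hη : 0 < η) (hb : ContinuousOn b (Ioo 0 m))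
    (hd : ∀ W ∈ Ioo 0 m, HasDerivAt d (b W * d W) W) (h0 : ∀ W ∈ Ioo 0 η, d W = 0) :
    ∀ W ∈ Ioo 0 m, d W = 0 := by
  intro W hW
  -- Gronwall starts at a point where d is already known to vanish, away from W = 0, where b may be
  -- unbounded.
  set s := min W η / 2 with hs
  have hs0 : 0 < s := half_pos (lt_min hW.1 hη)
  have hsη : s < η := (half_lt_self (lt_min hW.1 hη)).trans_le (min_le_right _ _)
  have hsW : s < W := (half_lt_self (lt_min hW.1 hη)).trans_le (min_le_left _ _)
  have hsub : Icc s W ⊆ Ioo 0 m := fun x hx => ⟨hs0.trans_le hx.1, hx.2.trans_lt hW.2⟩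
  obtain ⟨M, hM⟩ := isCompact_Icc.exists_bound_of_continuousOn (hb.mono hsub)
  have := norm_le_gronwallBound_of_norm_deriv_right_le (f := d) (f' := fun x => b x * d x)
    (δ := 0) (K := M) (ε := 0) (a := s) (b := W)
    (fun x hx => (hd x (hsub hx)).continuousAt.continuousWithinAt)
    (fun x hx => (hd x (hsub (Ico_subset_Icc_self hx))).hasDerivWithinAt)
    (by rw [h0 s ⟨hs0, hsη⟩]; simp)
    (fun x hx => by
      rw [norm_mul, add_zero]
      exact mul_le_mul_of_nonneg_right (hM x (Ico_subset_Icc_self hx)) (norm_nonneg _))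
    W ⟨hsW.le, le_rfl⟩
  simpa [gronwallBound_ε0] using this

/-! ### Blow-up of the origin and the trajectory -/

/-- `denZW W (W y) = W ^ 2 * reducedDen (W, y)`. -/
noncomputable def reducedDen (n : ℕ) (γ κ lam : ℝ) (p : ℝ × ℝ) : ℝ :=
  (lam - 1) - n * Wstar n γ κ lam * p.2 + p.1 * (n * p.2 - p.1 - ((lam - 1) - 1))

/-- The trajectories `Z = W y` are the solutions of `W y' = slopeField (W, y)`. -/
noncomputable def slopeField (n : ℕ) (γ κ lam : ℝ) (p : ℝ × ℝ) : ℝ :=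
  p.2 * ((κ + n) * p.2 - γ * (lam - 1) + p.1 * (2 * (p.2 - k1 n γ * p.1 + k2 n γ lam)
    - (n * p.2 - p.1 - ((lam - 1) - 1)))) / reducedDen n γ κ lam p

theorem natCast_pos_of_lt {n : ℕ} {γ lam : ℝ} (hμ : 0 < lam - 1)
    (hB : lam - 1 < n / 2 * (γ - 1)) : (0 : ℝ) < n := by
  rcases Nat.eq_zero_or_pos n with h | h
  · subst h; norm_num at hB; linarith
  · exact_mod_cast h

/-- This sum is the coefficient of y² in the blown-up numerator at W = 0; it is the reason why σ has
denominator κ + n. -/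
theorem two_alpha_add_mul_Wstar {n : ℕ} {γ κ lam : ℝ} (hn : (0 : ℝ) < n) (hγ : 1 < γ) :
    2 * alpha γ κ lam + n * Wstar n γ κ lam = κ + n := by
  have : γ ≠ 0 := by positivity
  unfold alpha Wstar Vstar
  field_simp
  ring

theorem denZW_mul (n : ℕ) (γ κ lam W y : ℝ) :
    denZW n γ κ lam W (W * y) = W ^ 2 * reducedDen n γ κ lam (W, y) := by
  unfold denZW reducedDen; ring

theorem numZW_div_denZW {n : ℕ} {γ κ lam W y : ℝ} (hn : (0 : ℝ) < n) (hγ : 1 < γ) (hW : W ≠ 0)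
    (hd : reducedDen n γ κ lam (W, y) ≠ 0) :
    numZW n γ κ lam W (W * y) / denZW n γ κ lam W (W * y) = y + slopeField n γ κ lam (W, y) := by
  have h1 := two_alpha_add_mul_Wstar (κ := κ) (lam := lam) hn hγ
  have h2 : alpha γ κ lam = (κ + n - n * Wstar n γ κ lam) / 2 := by linarith
  have h3 : y + slopeField n γ κ lam (W, y) =
      (W ^ 2 * (y * reducedDen n γ κ lam (W, y) + y * ((κ + n) * y - γ * (lam - 1) + W * (2 * (y - k1 n γ * W + k2 n γ lam)
    - (n * y - W - ((lam - 1) - 1)))))) / (W ^ 2 * reducedDen n γ κ lam (W, y)) := by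
    simp only [slopeField]
    field_simp
  rw [denZW_mul, h3]
  congr 1
  simp only [numZW, reducedDen, h2, k3]
  ring

theorem slope_pos {n : ℕ} {γ κ lam : ℝ} (hγ : 1 < γ)
    (hA : 0 < lam - 1 ∧ lam - 1 < (κ + n) / 2) : 0 < γ * (lam - 1) / (κ + n) := by
  have : 0 < κ + n := by linarith [hA.1, hA.2]
  have := hA.1
  positivity

/-- Condition (B) enters here: the value is −μ(n(γ−1) − 2μ)/(κ+n). -/
theorem reducedDen_slope_neg {n : ℕ} {γ κ lam : ℝ} (hγ : 1 < γ)
    (hA : 0 < lam - 1 ∧ lam - 1 < (κ + n) / 2) (hB : lam - 1 < n / 2 * (γ - 1)) :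
    reducedDen n γ κ lam (0, γ * (lam - 1) / (κ + n)) < 0 := by
  have hk : 0 < κ + n := by linarith [hA.1, hA.2]
  have hn := natCast_pos_of_lt hA.1 hB
  have hγ0 : 0 < γ := by linarith
  have : reducedDen n γ κ lam (0, γ * (lam - 1) / (κ + n))
      = -((lam - 1) * (n * (γ - 1) - 2 * (lam - 1)) / (κ + n)) := by
    unfold reducedDen Wstar Vstar
    field_simp
    ring
  rw [this, neg_lt_zero]
  exact div_pos (mul_pos hA.1 (by linarith)) hk

theorem contDiffAt_slopeField {n : ℕ} {γ κ lam : ℝ} {p : ℝ × ℝ}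
    (hp : reducedDen n γ κ lam p ≠ 0) : ContDiffAt ℝ 1 (slopeField n γ κ lam) p := by
  unfold slopeField
  refine ContDiffAt.div (by fun_prop) ?_ hp
  unfold reducedDen
  fun_prop

/-- The numerator vanishes at σ, so in the quotient rule only its own derivative, γμ, contributes.
-/
theorem hasDerivAt_slopeField_slope {n : ℕ} {γ κ lam σ : ℝ} (hσ : (κ + n) * σ = γ * (lam - 1))
    (hd : reducedDen n γ κ lam (0, σ) ≠ 0) :
    HasDerivAt (fun y => slopeField n γ κ lam (0, y))
      (-(γ * (lam - 1) / -reducedDen n γ κ lam (0, σ))) σ := by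
  have h1 : HasDerivAt (fun y : ℝ => y * ((κ + n) * y - γ * (lam - 1)))
      (γ * (lam - 1)) σ := by
    refine ((hasDerivAt_id σ).mul
      (((hasDerivAt_id σ).const_mul (κ + n)).sub_const (γ * (lam - 1)))).congr_deriv ?_
    simp only [id, ← hσ]
    ring
  have h2 : HasDerivAt (fun y : ℝ => reducedDen n γ κ lam (0, y)) (-(n * Wstar n γ κ lam)) σ := by
    unfold reducedDen
    refine ((((hasDerivAt_id σ).const_mul (n * Wstar n γ κ lam)).const_sub (lam - 1)).add
      ((((hasDerivAt_id σ).const_mul (n : ℝ)).sub_const 0 |>.sub_const ((lam - 1) - 1)).const_mul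
        0)).congr_deriv ?_
    simp
  have h3 := h1.div h2 hd
  have h4 : (fun y => slopeField n γ κ lam (0, y)) = fun y =>
      y * ((κ + n) * y - γ * (lam - 1)) / reducedDen n γ κ lam (0, y) := by
    funext y
    simp [slopeField]
  rw [h4]
  refine h3.congr_deriv ?_
  rw [hσ]
  field_simp
  ring

/-- The difference of two trajectories solves a homogeneous linear ODE. -/
theorem IsTrajectoryWithSlope.linear_ode_sub {n : ℕ} {γ κ lam s : ℝ} {z₁ z₂ : ℝ → ℝ} {m : ℝ}
    (h₁ : IsTrajectoryWithSlope n γ κ lam s z₁ m) (h₂ : IsTrajectoryWithSlope n γ κ lam s z₂ m) :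
    ∃ b : ℝ → ℝ, ContinuousOn b (Ioo 0 m) ∧
      ∀ W ∈ Ioo 0 m, HasDerivAt (fun W => z₁ W - z₂ W) (b W * (z₁ W - z₂ W)) W := by
  -- The denominator is c + e z and the numerator A z² + B z, so the cross-multiplied difference of
  -- the two right-hand sides is divisible by z₁ − z₂.
  let c : ℝ → ℝ := fun W => W ^ 2 * ((lam - 1) - W ^ 2 * 1 - ((lam - 1) - 1) * W)
  let e : ℝ → ℝ := fun W => W * (-(n * Wstar n γ κ lam) + n * W)
  let A : ℝ → ℝ := fun W => 2 * (alpha γ κ lam + W)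
  let B : ℝ → ℝ := fun W => 2 * W * (-k3 γ lam - k1 n γ * W ^ 2 + k2 n γ lam * W)
  have hz₁ : ContinuousOn z₁ (Ioo 0 m) := fun W hW =>
    (h₁.ode W hW).continuousAt.continuousWithinAt
  have hz₂ : ContinuousOn z₂ (Ioo 0 m) := fun W hW =>
    (h₂.ode W hW).continuousAt.continuousWithinAt
  refine ⟨fun W => (A W * c W * (z₁ W + z₂ W) + B W * c W + A W * e W * z₁ W * z₂ W) /
    (denZW n γ κ lam W (z₁ W) * denZW n γ κ lam W (z₂ W)), ?_, fun W hW => ?_⟩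
  · refine ContinuousOn.div ?_ ?_ fun W hW => mul_ne_zero (h₁.den_ne W hW) (h₂.den_ne W hW)
    · simp only [A, B, c, e]
      fun_prop
    · unfold denZW
      fun_prop
  · refine ((h₁.ode W hW).sub (h₂.ode W hW)).congr_deriv ?_
    rw [div_sub_div _ _ (h₁.den_ne W hW) (h₂.den_ne W hW), div_mul_eq_mul_div]
    congr 1
    simp only [A, B, c, e, numZW, denZW]
    ring

theorem IsTrajectoryWithSlope.mono {n : ℕ} {γ κ lam s : ℝ} {z : ℝ → ℝ} {δ δ' : ℝ}
    (h : IsTrajectoryWithSlope n γ κ lam s z δ) (h0 : 0 < δ') (hle : δ' ≤ δ) :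
    IsTrajectoryWithSlope n γ κ lam s z δ' where
  pos := h0
  den_ne := fun W hW => h.den_ne W ⟨hW.1, hW.2.trans_le hle⟩
  ode := fun W hW => h.ode W ⟨hW.1, hW.2.trans_le hle⟩
  tendsto_zero := h.tendsto_zero
  slope := h.slope

theorem IsTrajectoryWithSlope.hasDerivAt_div {n : ℕ} {γ κ lam s : ℝ} {z : ℝ → ℝ} {δ W : ℝ}
    (hn : (0 : ℝ) < n) (hγ : 1 < γ)
    (h : IsTrajectoryWithSlope n γ κ lam s z δ) (hW : W ∈ Ioo 0 δ) :
    HasDerivAt (fun W => z W / W) (slopeField n γ κ lam (W, z W / W) / W) W := by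
  have hW0 := hW.1.ne'
  have hz : z W = W * (z W / W) := by field_simp
  have hd := h.den_ne W hW
  rw [hz, denZW_mul] at hd
  have h1 := numZW_div_denZW hn hγ hW0 (right_ne_zero_of_mul hd)
  rw [← hz] at h1
  refine ((h.ode W hW).div (hasDerivAt_id W) hW0).congr_deriv ?_
  rw [h1]
  simp only [id]
  field_simp
  ring

/-- Existence and uniqueness of the trajectory `Z = W y W` with the nontrivial slope at `(0, 0)`. -/
theorem exists_trajectory {n : ℕ} {γ κ lam : ℝ} (hγ : 1 < γ)
    (hA : 0 < lam - 1 ∧ lam - 1 < (κ + n) / 2) (hB : lam - 1 < n / 2 * (γ - 1)) :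
    ∃ (y : ℝ → ℝ) (δ : ℝ), 0 < δ ∧ Continuous y ∧
      (∀ W ∈ Icc 0 δ, 0 < y W ∧ W < y W ∧ reducedDen n γ κ lam (W, y W) < 0) ∧
      IsTrajectoryWithSlope n γ κ lam (γ * (lam - 1) / (κ + n)) (fun W => W * y W) δ ∧
      ∀ (z : ℝ → ℝ) (δ' : ℝ),
        IsTrajectoryWithSlope n γ κ lam (γ * (lam - 1) / (κ + n)) z δ' →
          EqOn z (fun W => W * y W) (Ioo 0 (min δ δ')) := by
  have hn := natCast_pos_of_lt hA.1 hB
  have hk : 0 < κ + n := by linarith [hA.1, hA.2]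
  have hσ := slope_pos hγ hA
  have hneg := reducedDen_slope_neg hγ hA hB
  have hσk : (κ + n) * (γ * (lam - 1) / (κ + n)) = γ * (lam - 1) := by field_simp
  generalize γ * (lam - 1) / (κ + n) = σ at *
  have ha : 0 < γ * (lam - 1) / -reducedDen n γ κ lam (0, σ) :=
    div_pos (mul_pos (by linarith) hA.1) (by linarith)
  obtain ⟨r, hr, y, hy, hy0, hyd, huniq⟩ := exists_unique_solution_singular_ode ha
    (contDiffAt_slopeField hneg.ne) (by simp [slopeField, hσk])
    (hasDerivAt_slopeField_slope hσk hneg.ne)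
  have hden : Continuous fun W => reducedDen n γ κ lam (W, y W) := by
    unfold reducedDen; fun_prop
  -- The condition W < y W keeps the trajectory off the sonic lines, as D = W(W − y) on it.
  have hev : ∀ᶠ W in 𝓝 (0 : ℝ),
      W < r ∧ 0 < y W ∧ W < y W ∧ reducedDen n γ κ lam (W, y W) < 0 := by
    refine (eventually_lt_nhds hr).and (((hy.tendsto 0).eventually_const_lt (by rwa [hy0])).and
      (((continuous_id.tendsto 0).eventually_lt (hy.tendsto 0) ?_).and
        ((hden.tendsto 0).eventually_lt_const ?_)))
    · simpa [hy0] using hσ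
    · simpa [hy0] using hneg
  obtain ⟨ε, hε, hball⟩ := Metric.eventually_nhds_iff.1 hev
  have hP : ∀ W ∈ Icc 0 (ε / 2),
      W < r ∧ 0 < y W ∧ W < y W ∧ reducedDen n γ κ lam (W, y W) < 0 := fun W hW =>
    hball (by rw [Real.dist_eq, sub_zero, abs_of_nonneg hW.1]; linarith [hW.2])
  have htraj : IsTrajectoryWithSlope n γ κ lam σ (fun W => W * y W) (ε / 2) := by
    refine ⟨half_pos hε, fun W hW => ?_, fun W hW => ?_, ?_, ?_⟩
    · rw [denZW_mul]
      exact mul_ne_zero (pow_ne_zero _ hW.1.ne') (hP W (Ioo_subset_Icc_self hW)).2.2.2.ne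
    · have hW' := hP W (Ioo_subset_Icc_self hW)
      refine ((hasDerivAt_id W).mul (hyd W ⟨hW.1, hW'.1⟩)).congr_deriv ?_
      rw [numZW_div_denZW hn hγ hW.1.ne' hW'.2.2.2.ne]
      have := hW.1.ne'
      simp only [id]
      field_simp
    · have : Continuous fun W => W * y W := by fun_prop
      have h2 := this.tendsto 0
      simp only [zero_mul] at h2
      exact h2.mono_left nhdsWithin_le_nhds
    · have h2 := hy.tendsto 0
      rw [hy0] at h2
      refine (h2.mono_left nhdsWithin_le_nhds).congr' ?_
      filter_upwards [self_mem_nhdsWithin] with W hW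
      rw [mul_div_cancel_left₀ _ (ne_of_gt hW)]
  refine ⟨y, ε / 2, half_pos hε, hy, fun W hW => (hP W hW).2, htraj, fun z δ' hz => ?_⟩
  obtain ⟨η, hη, heq⟩ := huniq (fun W => z W / W) δ' hz.pos hz.slope
    fun W hW => hz.hasDerivAt_div hn hγ hW
  -- Agreement holds so far only on (0, η); the linear ODE for the difference carries it to the
  -- whole common interval.
  have hm : 0 < min (ε / 2) δ' := lt_min (half_pos hε) hz.pos
  obtain ⟨b, hb, hbd⟩ := (hz.mono hm (min_le_right _ _)).linear_ode_sub
    (htraj.mono hm (min_le_left _ _))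
  intro W hW
  refine sub_eq_zero.1 (eq_zero_of_linear_ode hη hb hbd (fun W hW => ?_) W hW)
  have h1 := heq hW
  have h2 := hW.1.ne'
  simp only at h1
  rw [← h1]
  field_simp
  ring

/-! ### Profiles reaching the critical point at finite x₀ -/

/-- The inverse of a primitive of a function that is bounded below by a positive constant. -/
theorem exists_autonomous_solution {h : ℝ → ℝ} {c : ℝ} (hh : Continuous h) (hc : 0 < c)
    (hle : ∀ W, c ≤ h W) (w : ℝ) :
    ∃ Ψ : ℝ → ℝ, Continuous Ψ ∧ StrictMono Ψ ∧ Function.Surjective Ψ ∧ Ψ 0 = w ∧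
      ∀ s, HasDerivAt Ψ (h (Ψ s))⁻¹ s := by
  let Φ : ℝ → ℝ := fun W => ∫ s in w..W, h s
  have hΦ : ∀ W, HasDerivAt Φ (h W) W := fun W => (hh.integral_hasStrictDerivAt w W).hasDerivAt
  have hmono : StrictMono Φ := strictMono_of_deriv_pos fun W => by
    rw [(hΦ W).deriv]; exact hc.trans_le (hle W)
  have hcont : Continuous Φ := continuous_iff_continuousAt.2 fun W => (hΦ W).continuousAt
  -- Growth at least as fast as c W makes the primitive surjective.
  have hdiff : Monotone fun W => Φ W - c * W := by
    have hd : ∀ W, HasDerivAt (fun W => Φ W - c * W) (h W - c * 1) W := fun W =>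
      (hΦ W).sub ((hasDerivAt_id W).const_mul c)
    refine monotone_of_deriv_nonneg (fun W => (hd W).differentiableAt) fun W => ?_
    rw [(hd W).deriv]
    linarith [hle W]
  have htop : Tendsto Φ atTop atTop := by
    refine tendsto_atTop_mono' atTop ?_ (tendsto_atTop_add_const_right _ (Φ 0 - c * 0)
      (tendsto_id.const_mul_atTop hc))
    filter_upwards [eventually_ge_atTop 0] with W hW
    have := hdiff hW
    simp only [id] at *
    linarith
  have hbot : Tendsto Φ atBot atBot := by
    refine tendsto_atBot_mono' atBot ?_ (tendsto_atBot_add_const_right _ (Φ 0 - c * 0)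
      (tendsto_id.const_mul_atBot hc))
    filter_upwards [eventually_le_atBot 0] with W hW
    have := hdiff hW
    simp only [id] at *
    linarith
  let e := hmono.orderIsoOfSurjective Φ (hcont.surjective htop hbot)
  have he : ∀ W, e W = Φ W := fun _ => rfl
  refine ⟨e.symm, e.symm.continuous, e.symm.strictMono, e.symm.surjective, ?_, fun s => ?_⟩
  · rw [OrderIso.symm_apply_eq, he]
    simp [Φ]
  · exact HasDerivAt.of_local_left_inverse e.symm.continuous.continuousAt (hΦ _)
      (hc.trans_le (hle _)).ne' (Eventually.of_forall fun y => e.apply_symm_apply y)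

theorem adiabatic_iff {q γ R W C x K : ℝ} (hR : 0 < R) (hW : 0 < W) (hC : 0 < C) (hx : x ≠ 0) :
    (R * |W|) ^ q * R ^ (1 - γ) * (C / x) ^ 2 = K ↔
      R ^ (q + 1 - γ) = K * x ^ 2 / (C ^ 2 * W ^ q) := by
  have h1 : (R * |W|) ^ q * R ^ (1 - γ) = R ^ (q + 1 - γ) * W ^ q := by
    rw [abs_of_pos hW, Real.mul_rpow hR.le hW.le, mul_right_comm, ← Real.rpow_add hR]
    ring_nf
  have h2 := (Real.rpow_pos_of_pos hW q).ne'
  rw [h1]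
  constructor
  · intro h
    rw [← h]
    field_simp
  · intro h
    rw [h]
    field_simp

/-- The right-hand side is negative precisely under (B), which fixes the sign of the exponent of R
in the adiabatic integral. -/
theorem add_mul_qExp_sub {n : ℕ} {γ κ lam : ℝ} (hγ : 1 < γ) (hk : κ + n ≠ 0) :
    (κ + n) * (qExp n γ κ lam + 1 - γ) = 2 * (lam - 1) - n * (γ - 1) := by
  have : γ ≠ 0 := by positivity
  unfold qExp alpha
  field_simp
  ring

theorem qExp_add_one_sub_neg {n : ℕ} {γ κ lam : ℝ} (hγ : 1 < γ)
    (hA : 0 < lam - 1 ∧ lam - 1 < (κ + n) / 2) (hB : lam - 1 < n / 2 * (γ - 1)) :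
    qExp n γ κ lam + 1 - γ < 0 := by
  have hk : 0 < κ + n := by linarith [hA.1, hA.2]
  have h1 := add_mul_qExp_sub (lam := lam) hγ hk.ne'
  by_contra hcon
  have := mul_nonneg hk.le (not_lt.1 hcon)
  linarith

/-- The factor W cancels against the one in D = W(W − y); this removes the singularity of G/D at the
critical point. -/
theorem G_eq (n : ℕ) (γ κ lam W y C : ℝ) (hC : C ^ 2 = W * y) :
    G n γ κ lam (W - 1) C = W * reducedDen n γ κ lam (W, y) := by
  unfold G reducedDen Wstar
  rw [hC]
  ring

theorem numZW_eq (n : ℕ) (γ κ lam W C : ℝ) (hW : W ≠ 0) :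
    numZW n γ κ lam W (C ^ 2) = 2 * C * W * F n γ κ lam (W - 1) C := by
  unfold numZW F
  rw [add_sub_cancel]
  field_simp
  ring

/-- Through each point of the trajectory passes a profile that reaches the critical point at a
finite value of the similarity variable. -/
theorem exists_profile {n : ℕ} {γ κ lam s δ : ℝ} {y : ℝ → ℝ} (hγ : 1 < γ)
    (hA : 0 < lam - 1 ∧ lam - 1 < (κ + n) / 2) (hB : lam - 1 < n / 2 * (γ - 1))
    (hy : Continuous y)
    (hpos : ∀ W ∈ Icc 0 δ, 0 < y W ∧ W < y W ∧ reducedDen n γ κ lam (W, y W) < 0)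
    (htraj : IsTrajectoryWithSlope n γ κ lam s (fun W => W * y W) δ)
    {K x₁ w : ℝ} (hK : 0 < K) (hx₁ : x₁ < 0) (hw : w ∈ Ioo 0 δ) :
    ∃ x₀ x₂ : ℝ, ∃ V C R : ℝ → ℝ, x₀ < x₁ ∧ x₁ < x₂ ∧
      IsProfileAlong n γ κ lam (fun W => W * y W) δ V C R K x₀ x₂ ∧ 1 + V x₁ = w := by
  have hlam : 0 < lam := by linarith [hA.1]
  have hδ := htraj.pos
  have hp := qExp_add_one_sub_neg hγ hA hB
  -- In s = log(x₁/x) the equation for W = 1 + V is dW/ds = 1/H(W). H is continuous and positive on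
  -- the closed interval, W = 0 included; it is extended by constants so that the solution is
  -- global.
  let H : ℝ → ℝ := fun W => lam * (W - y W) / reducedDen n γ κ lam (W, y W)
  have hHpos : ∀ W ∈ Icc 0 δ, 0 < H W := fun W hW =>
    div_pos_of_neg_of_neg (mul_neg_of_pos_of_neg hlam (by linarith [(hpos W hW).2.1]))
      (hpos W hW).2.2
  have hHcont : ContinuousOn H (Icc 0 δ) := by
    refine ContinuousOn.div (by fun_prop) ?_ fun W hW => (hpos W hW).2.2.ne
    unfold reducedDen
    fun_prop
  obtain ⟨W₀, hW₀, hmin⟩ := isCompact_Icc.exists_isMinOn (nonempty_Icc.2 hδ.le) hHcont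
  obtain ⟨Ψ, hΨ, hΨm, hΨs, hΨ0, hΨd⟩ := exists_autonomous_solution
    (hHcont.domRestrict.Icc_extend' (h := hδ.le)) (hHpos W₀ hW₀)
    (fun W => hmin (projIcc 0 δ hδ.le W).2) w
  -- The values of s at which W reaches 0 and δ give the endpoints x₀ = x₁ exp(−s₀) and x₂ = x₁
  -- exp(−s₂).
  obtain ⟨s₀, hs₀⟩ := hΨs 0
  obtain ⟨s₂, hs₂⟩ := hΨs δ
  have hs₀neg : s₀ < 0 := hΨm.lt_iff_lt.1 (by rw [hs₀, hΨ0]; exact hw.1)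
  have hs₂pos : 0 < s₂ := hΨm.lt_iff_lt.1 (by rw [hs₂, hΨ0]; exact hw.2)
  have hx₀ : x₁ * Real.exp (-s₀) < 0 := mul_neg_of_neg_of_pos hx₁ (Real.exp_pos _)
  have hx₂ : x₁ * Real.exp (-s₂) < 0 := mul_neg_of_neg_of_pos hx₁ (Real.exp_pos _)
  have hlog : ∀ a, Real.log (x₁ / (x₁ * Real.exp (-a))) = a := fun a => by
    rw [div_mul_cancel_left₀ hx₁.ne, ← Real.exp_neg, neg_neg, Real.log_exp]
  have h01 : x₁ * Real.exp (-s₀) < x₁ := by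
    have : 1 < Real.exp (-s₀) := Real.one_lt_exp_iff.2 (by linarith)
    nlinarith
  have h12 : x₁ < x₁ * Real.exp (-s₂) := by
    have : Real.exp (-s₂) < 1 := Real.exp_lt_one_iff.2 (by linarith)
    nlinarith
  let U : ℝ → ℝ := fun x => Ψ (Real.log (x₁ / x))
  have hUm : ∀ x ∈ Ioo (x₁ * Real.exp (-s₀)) (x₁ * Real.exp (-s₂)), U x ∈ Ioo 0 δ := by
    intro x hx
    have hx0 : x < 0 := hx.2.trans hx₂
    constructor
    · rw [← hs₀]
      apply hΨm
      rw [← hlog s₀]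
      refine Real.log_lt_log (div_pos_of_neg_of_neg hx₁ hx₀) ?_
      rw [div_eq_mul_inv, div_eq_mul_inv]
      exact mul_lt_mul_of_neg_left ((inv_lt_inv_of_neg hx0 hx₀).2 hx.1) hx₁
    · rw [← hs₂]
      apply hΨm
      rw [← hlog s₂]
      refine Real.log_lt_log (div_pos_of_neg_of_neg hx₁ hx0) ?_
      rw [div_eq_mul_inv, div_eq_mul_inv]
      exact mul_lt_mul_of_neg_left ((inv_lt_inv_of_neg hx₂ hx0).2 hx.2) hx₁
  have hlogd : ∀ x < 0, HasDerivAt (fun x => Real.log (x₁ / x)) (-x⁻¹) x := by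
    intro x hx
    have h1 := ((hasDerivAt_inv hx.ne).const_mul x₁).log
      (mul_ne_zero hx₁.ne (inv_ne_zero hx.ne))
    have h2 := hx₁.ne
    have h3 := hx.ne
    exact h1.congr_deriv (by field_simp)
  have hUd : ∀ x ∈ Ioo (x₁ * Real.exp (-s₀)) (x₁ * Real.exp (-s₂)),
      HasDerivAt U (-(1 / (lam * x)) * (reducedDen n γ κ lam (U x, y (U x)) /
        (U x - y (U x)))) x := by
    intro x hx
    have hx0 : x < 0 := hx.2.trans hx₂
    have hU := Ioo_subset_Icc_self (hUm x hx)
    refine ((hΨd _).comp x (hlogd x hx0)).congr_deriv ?_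
    have hHU : IccExtend hδ.le ((Icc 0 δ).domRestrict H) (Ψ (Real.log (x₁ / x))) = H (U x) :=
      IccExtend_of_mem hδ.le _ hU
    rw [hHU]
    have h1 := (hpos _ hU).2.2.ne
    have h2 : U x - y (U x) ≠ 0 := sub_ne_zero.2 (hpos _ hU).2.1.ne
    have h3 := hx0.ne
    simp only [H]
    field_simp
  have hUc : ContinuousAt U (x₁ * Real.exp (-s₀)) :=
    hΨ.continuousAt.comp (hlogd _ hx₀).continuousAt
  have hU0 : U (x₁ * Real.exp (-s₀)) = 0 := by simp only [U]; rw [hlog, hs₀]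
  have hUt : Tendsto U (𝓝[>] (x₁ * Real.exp (-s₀))) (𝓝 0) := by
    have := hUc.tendsto
    rw [hU0] at this
    exact this.mono_left nhdsWithin_le_nhds
  let C : ℝ → ℝ := fun x => √(U x * y (U x))
  have hZpos : ∀ x ∈ Ioo (x₁ * Real.exp (-s₀)) (x₁ * Real.exp (-s₂)), 0 < U x * y (U x) :=
    fun x hx => mul_pos (hUm x hx).1 (hpos _ (Ioo_subset_Icc_self (hUm x hx))).1
  have hCpos : ∀ x ∈ Ioo (x₁ * Real.exp (-s₀)) (x₁ * Real.exp (-s₂)), 0 < C x :=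
    fun x hx => Real.sqrt_pos.2 (hZpos x hx)
  have hCsq : ∀ x ∈ Ioo (x₁ * Real.exp (-s₀)) (x₁ * Real.exp (-s₂)),
      C x ^ 2 = U x * y (U x) := fun x hx => Real.sq_sqrt (hZpos x hx).le
  let R : ℝ → ℝ := fun x =>
    (K * x ^ 2 / (C x ^ 2 * U x ^ qExp n γ κ lam)) ^ (qExp n γ κ lam + 1 - γ)⁻¹
  have hRbase : ∀ x ∈ Ioo (x₁ * Real.exp (-s₀)) (x₁ * Real.exp (-s₂)),
      0 < K * x ^ 2 / (C x ^ 2 * U x ^ qExp n γ κ lam) := by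
    intro x hx
    have h1 := hCpos x hx
    have h2 := Real.rpow_pos_of_pos (hUm x hx).1 (qExp n γ κ lam)
    have h3 : x ≠ 0 := (hx.2.trans hx₂).ne
    positivity
  refine ⟨x₁ * Real.exp (-s₀), x₁ * Real.exp (-s₂), fun x => U x - 1, C, R, h01, h12, ?_, ?_⟩
  · refine ⟨h01.trans h12, hx₂.le, fun x hx => ?_, hCpos, fun x hx => ?_, fun x hx => ?_, ?_, ?_,
      hK, fun x hx => Real.rpow_pos_of_pos (hRbase x hx) _, fun x hx => ?_⟩
    · have hU := hUm x hx
      have hU' := hpos _ (Ioo_subset_Icc_self hU)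
      have hx0 : x ≠ 0 := (hx.2.trans hx₂).ne
      have hD : D (U x - 1) (C x) = U x * (U x - y (U x)) := by
        unfold D; rw [hCsq x hx]; ring
      have hG := G_eq n γ κ lam (U x) (y (U x)) (C x) (hCsq x hx)
      have hsub : U x - y (U x) ≠ 0 := sub_ne_zero.2 hU'.2.1.ne
      have hU0 := hU.1.ne'
      have hC0 := (hCpos x hx).ne'
      have hred := hU'.2.2.ne
      refine ⟨by rw [hD]; exact mul_ne_zero hU0 hsub, ?_, ?_⟩
      · refine ((hUd x hx).sub_const 1).congr_deriv ?_
        rw [hG, hD]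
        field_simp
      · have h1 := (htraj.ode (U x) hU).comp x (hUd x hx)
        have h2 := h1.sqrt (hZpos x hx).ne'
        refine h2.congr_deriv ?_
        change _ / (2 * C x) = _
        rw [denZW_mul, ← hCsq x hx, numZW_eq _ _ _ _ _ _ hU0, hD]
        field_simp
    · simpa using hUm x hx
    · simpa using hCsq x hx
    · simpa using hUt.sub_const 1
    · have h1 : Continuous fun W => √(W * y W) := by fun_prop
      have h2 := (h1.tendsto 0).comp hUt
      simpa [C, Function.comp_def] using h2
    · rw [add_sub_cancel, adiabatic_iff (Real.rpow_pos_of_pos (hRbase x hx) _) (hUm x hx).1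
        (hCpos x hx) (hx.2.trans hx₂).ne, ← Real.rpow_mul (hRbase x hx).le,
        inv_mul_cancel₀ hp.ne, Real.rpow_one]
  · simp only [U, div_self hx₁.ne, Real.log_one, hΨ0]
    ring

/-! ### Self-similar fields and the Euler system -/

theorem hasDerivAt_similarity_r {lam t r : ℝ} (hr : 0 < r) :
    HasDerivAt (fun y : ℝ => t / y ^ lam) (-(lam * (t / r ^ lam) / r)) r := by
  have h := (Real.rpow_pos_of_pos hr lam).ne'
  refine ((Real.hasDerivAt_rpow_const (p := lam) (Or.inl hr.ne')).inv h |>.const_mul t).congr_deriv ?_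
  rw [Real.rpow_sub_one hr.ne']
  field_simp

theorem hasDerivAt_rpow_div {s r : ℝ} (hr : 0 < r) :
    HasDerivAt (fun y : ℝ => y ^ s) (s * r ^ s / r) r := by
  refine (Real.hasDerivAt_rpow_const (p := s) (Or.inl hr.ne')).congr_deriv ?_
  rw [Real.rpow_sub_one hr.ne']
  ring

theorem hasDerivAt_density_t {κ lam t r R' : ℝ} {R : ℝ → ℝ}
    (hR : HasDerivAt R R' (t / r ^ lam)) :
    HasDerivAt (fun τ => density κ lam R τ r) (r ^ κ * (R' / r ^ lam)) t := by
  refine ((hR.comp t ((hasDerivAt_id t).div_const (r ^ lam))).const_mul (r ^ κ)).congr_deriv ?_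
  ring

theorem hasDerivAt_density_r {κ lam t r R' : ℝ} {R : ℝ → ℝ} (hr : 0 < r)
    (hR : HasDerivAt R R' (t / r ^ lam)) :
    HasDerivAt (fun y => density κ lam R t y)
      (r ^ κ / r * (κ * R (t / r ^ lam) - lam * (t / r ^ lam) * R')) r := by
  refine ((hasDerivAt_rpow_div (s := κ) hr).mul
    (hR.comp r (hasDerivAt_similarity_r hr))).congr_deriv ?_
  simp only [Function.comp]
  ring

theorem hasDerivAt_speed_t {lam t r Φ' : ℝ} {Φ : ℝ → ℝ} (hr : 0 < r) (ht : t ≠ 0)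
    (hlam : lam ≠ 0) (hΦ : HasDerivAt Φ Φ' (t / r ^ lam)) :
    HasDerivAt (fun τ => speed lam Φ τ r)
      (-(r / (lam * (r ^ lam) ^ 2)) *
        (((t / r ^ lam) * Φ' - Φ (t / r ^ lam)) / (t / r ^ lam) ^ 2)) t := by
  have h := (Real.rpow_pos_of_pos hr lam).ne'
  have hx := (hasDerivAt_id t).div_const (r ^ lam)
  refine (((hΦ.comp t hx).div hx (div_ne_zero ht h)).const_mul
    (-(r ^ (1 - lam) / lam))).congr_deriv ?_
  rw [Real.rpow_sub hr, Real.rpow_one]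
  simp only [Function.comp, id]
  field_simp

theorem hasDerivAt_speed_r {lam t r Φ' : ℝ} {Φ : ℝ → ℝ} (hr : 0 < r) (ht : t ≠ 0)
    (hlam : lam ≠ 0) (hΦ : HasDerivAt Φ Φ' (t / r ^ lam)) :
    HasDerivAt (fun y => speed lam Φ t y)
      (-(1 / (lam * r ^ lam)) * (Φ (t / r ^ lam) / (t / r ^ lam) - lam * Φ')) r := by
  have h := (Real.rpow_pos_of_pos hr lam).ne'
  have hx := hasDerivAt_similarity_r (lam := lam) (t := t) hr
  refine ((((hasDerivAt_rpow_div (s := 1 - lam) hr).div_const lam).neg).mul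
    ((hΦ.comp r hx).div hx (div_ne_zero ht h))).congr_deriv ?_
  rw [Real.rpow_sub hr, Real.rpow_one]
  simp only [Function.comp, Pi.div_apply, Pi.neg_apply]
  rw [Real.rpow_sub hr, Real.rpow_one]
  field_simp
  ring

theorem speed_eq {lam t r : ℝ} {Φ : ℝ → ℝ} (hr : 0 < r) :
    speed lam Φ t r = -(r / (lam * r ^ lam)) * (Φ (t / r ^ lam) / (t / r ^ lam)) := by
  unfold speed
  rw [Real.rpow_sub hr, Real.rpow_one]
  field_simp

theorem contDiffOn_similarity {lam : ℝ} {Ω : Set (ℝ × ℝ)} (hΩ : ∀ p ∈ Ω, 0 < p.2) :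
    ContDiffOn ℝ 1 (fun p : ℝ × ℝ => p.1 / p.2 ^ lam) Ω := by
  refine contDiffOn_fst.div ?_ fun p hp => (Real.rpow_pos_of_pos (hΩ p hp) _).ne'
  exact contDiffOn_snd.rpow_const_of_ne fun p hp => (hΩ p hp).ne'

theorem contDiffOn_density {κ lam : ℝ} {R : ℝ → ℝ} {Ω : Set (ℝ × ℝ)} {I : Set ℝ}
    (hR : ContDiffOn ℝ 1 R I) (hΩ : ∀ p ∈ Ω, 0 < p.2)
    (hmaps : MapsTo (fun p : ℝ × ℝ => p.1 / p.2 ^ lam) Ω I) :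
    ContDiffOn ℝ 1 (fun p : ℝ × ℝ => density κ lam R p.1 p.2) Ω :=
  (contDiffOn_snd.rpow_const_of_ne fun p hp => (hΩ p hp).ne').mul
    (hR.comp (contDiffOn_similarity hΩ) hmaps)

theorem contDiffOn_speed {lam : ℝ} {Φ : ℝ → ℝ} {Ω : Set (ℝ × ℝ)} {I : Set ℝ}
    (hΦ : ContDiffOn ℝ 1 Φ I) (hI : ∀ x ∈ I, x ≠ 0) (hΩ : ∀ p ∈ Ω, 0 < p.2)
    (hmaps : MapsTo (fun p : ℝ × ℝ => p.1 / p.2 ^ lam) Ω I) :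
    ContDiffOn ℝ 1 (fun p : ℝ × ℝ => speed lam Φ p.1 p.2) Ω := by
  have hx := contDiffOn_similarity (lam := lam) hΩ
  have h1 : ContDiffOn ℝ 1 (fun p : ℝ × ℝ => p.2 ^ (1 - lam)) Ω :=
    contDiffOn_snd.rpow_const_of_ne fun p hp => (hΩ p hp).ne'
  exact (h1.div_const lam).neg.mul
    ((hΦ.comp hx hmaps).div hx fun p hp => hI _ (hmaps hp))

theorem contDiffOn_one_of_hasDerivAt {f f' : ℝ → ℝ} {s : Set ℝ} (hs : IsOpen s)
    (hf : ∀ x ∈ s, HasDerivAt f (f' x) x) (hf' : ContinuousOn f' s) : ContDiffOn ℝ 1 f s := by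
  have : ((0 : WithTop ℕ∞) + 1) = 1 := by norm_num
  rw [← this, contDiffOn_succ_iff_deriv_of_isOpen hs]
  refine ⟨fun x hx => (hf x hx).differentiableAt.differentiableWithinAt, by simp, ?_⟩
  rw [contDiffOn_zero]
  exact hf'.congr fun x hx => (hf x hx).deriv

/-- The profile equations for `V`, `C` and `R` imply
the radial Euler system for the associated flow. -/
theorem isRadialEulerFlow_of_profile_equations {n : ℕ} {γ κ lam x₀ x₂ : ℝ}
    {V C R V' C' R' : ℝ → ℝ} (hγ : γ ≠ 0) (hlam : lam ≠ 0) (hx₂ : x₂ ≤ 0)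
    (hV : ∀ x ∈ Ioo x₀ x₂, HasDerivAt V (V' x) x) (hC : ∀ x ∈ Ioo x₀ x₂, HasDerivAt C (C' x) x)
    (hR : ∀ x ∈ Ioo x₀ x₂, HasDerivAt R (R' x) x)
    (hV' : ContinuousOn V' (Ioo x₀ x₂)) (hC' : ContinuousOn C' (Ioo x₀ x₂))
    (hR' : ContinuousOn R' (Ioo x₀ x₂)) (hR0 : ∀ x ∈ Ioo x₀ x₂, R x ≠ 0)
    (hmass : ∀ x ∈ Ioo x₀ x₂,
      (1 + V x) * R' x + R x * (V' x - (κ + n) * V x / (lam * x)) = 0)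
    (hmom : ∀ x ∈ Ioo x₀ x₂,
      (1 + V x) * V' x - V x / x * (1 + V x / lam)
        - C x ^ 2 / (γ * lam * x) * (κ - lam * x * (R' x / R x))
        - 2 * C x / (γ * lam) * (C x / x - lam * C' x) = 0)
    (hen : ∀ x ∈ Ioo x₀ x₂,
      (1 + V x) * C' x + (γ - 1) / 2 * C x * V' x
        - C x / x * (1 + V x / lam + (γ - 1) * n * V x / (2 * lam)) = 0) :
    IsRadialEulerFlow n γ (density κ lam R) (speed lam V) (speed lam C)
      (fluidRegion lam x₀ x₂) := by
  have hΩ : ∀ p ∈ fluidRegion lam x₀ x₂, 0 < p.2 := fun p hp => hp.2.1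
  have hmaps : MapsTo (fun p : ℝ × ℝ => p.1 / p.2 ^ lam) (fluidRegion lam x₀ x₂) (Ioo x₀ x₂) :=
    fun p hp => hp.2.2
  have hI : ∀ x ∈ Ioo x₀ x₂, x ≠ 0 := fun x hx => (hx.2.trans_le hx₂).ne
  refine ⟨contDiffOn_density (contDiffOn_one_of_hasDerivAt isOpen_Ioo hR hR') hΩ hmaps,
    contDiffOn_speed (contDiffOn_one_of_hasDerivAt isOpen_Ioo hV hV') hI hΩ hmaps,
    contDiffOn_speed (contDiffOn_one_of_hasDerivAt isOpen_Ioo hC hC') hI hΩ hmaps, ?_, ?_, ?_⟩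
  · rintro t r ⟨ht, hr, hx⟩
    simp only at ht hr hx
    rw [(hasDerivAt_density_t (hR _ hx)).deriv, (hasDerivAt_density_r hr (hR _ hx)).deriv,
      (hasDerivAt_speed_r hr ht.ne hlam (hV _ hx)).deriv, speed_eq hr]
    have hm := hmass _ hx
    have hx0 := hI _ hx
    have hω := (Real.rpow_pos_of_pos hr lam).ne'
    have hr0 := hr.ne'
    unfold density
    generalize t / r ^ lam = x at *
    generalize r ^ lam = ω at *
    calc _ = r ^ κ / ω * ((1 + V x) * R' x + R x * (V' x - (κ + n) * V x / (lam * x))) := by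
          field_simp
          ring
      _ = 0 := by rw [hm, mul_zero]
  · rintro t r ⟨ht, hr, hx⟩
    simp only at ht hr hx
    have hcr := hasDerivAt_speed_r hr ht.ne hlam (hC _ hx)
    have hρr := hasDerivAt_density_r (κ := κ) hr (hR _ hx)
    have hp : HasDerivAt (fun y => density κ lam R t y * speed lam C t y ^ 2)
        (r ^ κ / r * (κ * R (t / r ^ lam) - lam * (t / r ^ lam) * R' (t / r ^ lam)) *
          speed lam C t r ^ 2 + density κ lam R t r * (2 * speed lam C t r *
            (-(1 / (lam * r ^ lam)) * (C (t / r ^ lam) / (t / r ^ lam)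
              - lam * C' (t / r ^ lam))))) r :=
      hρr.mul ((hcr.pow 2).congr_deriv (by simp))
    rw [hp.deriv, (hasDerivAt_speed_t hr ht.ne hlam (hV _ hx)).deriv,
      (hasDerivAt_speed_r hr ht.ne hlam (hV _ hx)).deriv, speed_eq hr, speed_eq hr]
    have hm := hmom _ hx
    have hR0 := hR0 _ hx
    have hx0 := hI _ hx
    have hω := (Real.rpow_pos_of_pos hr lam).ne'
    have hκ := (Real.rpow_pos_of_pos hr κ).ne'
    have hr0 := hr.ne'
    unfold density
    generalize t / r ^ lam = x at *
    generalize r ^ lam = ω at *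
    generalize r ^ κ = k at *
    calc _ = -(r / (lam * ω ^ 2 * x)) * ((1 + V x) * V' x - V x / x * (1 + V x / lam)
        - C x ^ 2 / (γ * lam * x) * (κ - lam * x * (R' x / R x))
        - 2 * C x / (γ * lam) * (C x / x - lam * C' x)) := by
          field_simp
          ring
      _ = 0 := by rw [hm, mul_zero]
  · rintro t r ⟨ht, hr, hx⟩
    simp only at ht hr hx
    rw [(hasDerivAt_speed_t hr ht.ne hlam (hC _ hx)).deriv,
      (hasDerivAt_speed_r hr ht.ne hlam (hC _ hx)).deriv,
      (hasDerivAt_speed_r hr ht.ne hlam (hV _ hx)).deriv, speed_eq hr, speed_eq hr]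
    have hm := hen _ hx
    have hx0 := hI _ hx
    have hω := (Real.rpow_pos_of_pos hr lam).ne'
    have hr0 := hr.ne'
    generalize t / r ^ lam = x at *
    generalize r ^ lam = ω at *
    calc _ = -(r / (lam * ω ^ 2 * x)) * ((1 + V x) * C' x + (γ - 1) / 2 * C x * V' x
        - C x / x * (1 + V x / lam + (γ - 1) * n * V x / (2 * lam))) := by
          field_simp
          ring
      _ = 0 := by rw [hm, mul_zero]

/-! ### Algebraic identities behind the profile equations -/

/-- This is the vanishing logarithmic derivative of the adiabatic integral, with R'/R taken from the
mass equation and denominators cleared. -/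
theorem F_div_mul_add {n : ℕ} {γ κ lam V C : ℝ} (hn : (0 : ℝ) < n) (hγ : 1 < γ) (hW : 1 + V ≠ 0)
    (hC : C ≠ 0) :
    2 * lam * D V C * (1 + V) + 2 * (F n γ κ lam V C / C) * (1 + V) + (γ - 1) * G n γ κ lam V C
      - (2 * (lam - 1) - n * (γ - 1)) * V * D V C = 0 := by
  have : γ ≠ 0 := by positivity
  unfold F G D Vstar alpha k1 k2 k3
  field_simp
  ring

theorem energy_identity {n : ℕ} {γ κ lam V C x : ℝ} (hn : (0 : ℝ) < n) (hγ : 1 < γ)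
    (hlam : lam ≠ 0) (hx : x ≠ 0) (hW : 1 + V ≠ 0) (hD : D V C ≠ 0) :
    (1 + V) * (-(1 / (lam * x)) * (F n γ κ lam V C / D V C))
      + (γ - 1) / 2 * C * (-(1 / (lam * x)) * (G n γ κ lam V C / D V C))
      - C / x * (1 + V / lam + (γ - 1) * n * V / (2 * lam)) = 0 := by
  have hγ0 : γ ≠ 0 := by positivity
  have h : (1 + V) * F n γ κ lam V C + (γ - 1) / 2 * C * G n γ κ lam V C
      + C * D V C * (lam + V + (γ - 1) * n * V / 2) = 0 := by
    unfold F G D Vstar alpha k1 k2 k3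
    field_simp
    ring
  calc _ = -(1 / (lam * x * D V C)) * ((1 + V) * F n γ κ lam V C
      + (γ - 1) / 2 * C * G n γ κ lam V C
      + C * D V C * (lam + V + (γ - 1) * n * V / 2)) := by
        field_simp
        ring
    _ = 0 := by rw [h, mul_zero]

/-- R'/R is replaced by the value that the mass equation prescribes, so only V and C remain. -/
theorem momentum_identity {n : ℕ} {γ κ lam V C x : ℝ} (hn : (0 : ℝ) < n) (hγ : 1 < γ)
    (hlam : lam ≠ 0) (hx : x ≠ 0) (hW : 1 + V ≠ 0) (hD : D V C ≠ 0) :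
    (1 + V) * (-(1 / (lam * x)) * (G n γ κ lam V C / D V C)) - V / x * (1 + V / lam)
      - C ^ 2 / (γ * lam * x) * (κ - lam * x *
        (-((-(1 / (lam * x)) * (G n γ κ lam V C / D V C)) - (κ + n) * V / (lam * x)) / (1 + V)))
      - 2 * C / (γ * lam) * (C / x - lam * (-(1 / (lam * x)) * (F n γ κ lam V C / D V C))) = 0 := by
  have hγ0 : γ ≠ 0 := by positivity
  have h : γ * (1 + V) ^ 2 * G n γ κ lam V C + γ * (1 + V) * V * D V C * (lam + V)
      + C ^ 2 * (κ * (1 + V) * D V C - G n γ κ lam V C - (κ + n) * V * D V C)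
      + 2 * C * (1 + V) * (C * D V C + F n γ κ lam V C) = 0 := by
    unfold F G D Vstar alpha k1 k2 k3
    field_simp
    ring
  calc _ = -(1 / (γ * lam * x * D V C * (1 + V))) *
      (γ * (1 + V) ^ 2 * G n γ κ lam V C + γ * (1 + V) * V * D V C * (lam + V)
      + C ^ 2 * (κ * (1 + V) * D V C - G n γ κ lam V C - (κ + n) * V * D V C)
      + 2 * C * (1 + V) * (C * D V C + F n γ κ lam V C)) := by
        field_simp
        ring
    _ = 0 := by rw [h, mul_zero]

/-- The left side is R'/R from the adiabatic integral, the right side R'/R as required by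
conservation of mass. -/
theorem mass_identity {n : ℕ} {γ κ lam V C x : ℝ} (hn : (0 : ℝ) < n) (hγ : 1 < γ)
    (hk : κ + n ≠ 0) (hq : qExp n γ κ lam + 1 - γ ≠ 0)
    (hlam : lam ≠ 0) (hx : x ≠ 0) (hW : 1 + V ≠ 0) (hC : C ≠ 0) (hD : D V C ≠ 0) :
    (qExp n γ κ lam + 1 - γ)⁻¹ * (2 / x - 2 * (-(1 / (lam * x)) * (F n γ κ lam V C / D V C)) / C
      - qExp n γ κ lam * (-(1 / (lam * x)) * (G n γ κ lam V C / D V C)) / (1 + V)) =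
    -((-(1 / (lam * x)) * (G n γ κ lam V C / D V C)) - (κ + n) * V / (lam * x)) / (1 + V) := by
  have h1 := F_div_mul_add (κ := κ) (lam := lam) hn hγ hW hC
  rw [← add_mul_qExp_sub hγ hk] at h1
  rw [inv_mul_eq_iff_eq_mul₀ hq]
  rw [← sub_eq_zero]
  calc _ = 1 / (lam * x * D V C * (1 + V)) * (2 * lam * D V C * (1 + V)
      + 2 * (F n γ κ lam V C / C) * (1 + V) + (γ - 1) * G n γ κ lam V C
      - (κ + n) * (qExp n γ κ lam + 1 - γ) * V * D V C) := by
        field_simp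
        ring
    _ = 0 := by rw [h1, mul_zero]

/-! ### Density, flow and vanishing pressure along a profile -/

section Profile

variable {n : ℕ} {γ κ lam δ K x₀ x₂ : ℝ} {z V C R : ℝ → ℝ}

theorem IsProfileAlong.ne_zero (h : IsProfileAlong n γ κ lam z δ V C R K x₀ x₂) {x : ℝ}
    (hx : x ∈ Ioo x₀ x₂) : x ≠ 0 := (hx.2.trans_le h.nonpos).ne

theorem IsProfileAlong.R_rpow (h : IsProfileAlong n γ κ lam z δ V C R K x₀ x₂) {x : ℝ}
    (hx : x ∈ Ioo x₀ x₂) : R x ^ (qExp n γ κ lam + 1 - γ) =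
      K * x ^ 2 / (C x ^ 2 * (1 + V x) ^ qExp n γ κ lam) :=
  (adiabatic_iff (h.R_pos x hx) (h.mem x hx).1 (h.C_pos x hx) (h.ne_zero hx)).1 (h.adiabatic x hx)

theorem IsProfileAlong.hasDerivAt_R (h : IsProfileAlong n γ κ lam z δ V C R K x₀ x₂)
    (hn : (0 : ℝ) < n) (hγ : 1 < γ) (hk : κ + n ≠ 0) (hq : qExp n γ κ lam + 1 - γ ≠ 0)
    (hlam : lam ≠ 0) {x : ℝ} (hx : x ∈ Ioo x₀ x₂) :
    HasDerivAt R (R x * (-((-(1 / (lam * x)) * (G n γ κ lam (V x) (C x) / D (V x) (C x)))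
      - (κ + n) * V x / (lam * x)) / (1 + V x))) x := by
  -- Here t < 0, and `Real.log t` is log |t|, as the square t² requires.
  have hform : ∀ t ∈ Ioo x₀ x₂, R t = Real.exp ((qExp n γ κ lam + 1 - γ)⁻¹ *
      (Real.log K + 2 * Real.log t - 2 * Real.log (C t)
        - qExp n γ κ lam * Real.log (1 + V t))) := by
    intro t ht
    have h1 := congrArg Real.log (h.R_rpow ht)
    have hC := h.C_pos t ht
    have hW := (h.mem t ht).1
    have hWq := Real.rpow_pos_of_pos hW (qExp n γ κ lam)
    have ht0 := h.ne_zero ht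
    have hK := h.K_pos
    rw [Real.log_rpow (h.R_pos t ht), Real.log_div (by positivity) (by positivity),
      Real.log_mul hK.ne' (by positivity), Real.log_mul (by positivity) hWq.ne',
      Real.log_pow, Real.log_pow, Real.log_rpow hW] at h1
    rw [← Real.exp_log (h.R_pos t ht)]
    congr 1
    rw [eq_inv_mul_iff_mul_eq₀ hq, h1]
    push_cast
    ring
  obtain ⟨hD, hV', hC'⟩ := h.sol x hx
  have hC := (h.C_pos x hx).ne'
  have hW := (h.mem x hx).1.ne'
  have hx0 := h.ne_zero hx
  have hd := (((((Real.hasDerivAt_log hx0).const_mul 2).const_add (Real.log K)).sub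
    ((hC'.log hC).const_mul 2)).sub (((hV'.const_add 1).log hW).const_mul
      (qExp n γ κ lam))).const_mul (qExp n γ κ lam + 1 - γ)⁻¹ |>.exp
  have heq : R =ᶠ[𝓝 x] _ := Filter.mem_of_superset (Ioo_mem_nhds hx.1 hx.2) hform
  refine (hd.congr_of_eventuallyEq heq).congr_deriv ?_
  rw [← mass_identity hn hγ hk hq hlam hx0 hW hC hD, hform x hx]
  simp only [Pi.sub_apply]
  ring

theorem IsProfileAlong.isRadialEulerFlow (h : IsProfileAlong n γ κ lam z δ V C R K x₀ x₂)
    (hn : (0 : ℝ) < n) (hγ : 1 < γ) (hk : κ + n ≠ 0) (hq : qExp n γ κ lam + 1 - γ ≠ 0)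
    (hlam : lam ≠ 0) :
    IsRadialEulerFlow n γ (density κ lam R) (speed lam V) (speed lam C)
      (fluidRegion lam x₀ x₂) := by
  have hVd := fun x hx => (h.sol x hx).2.1
  have hCd := fun x hx => (h.sol x hx).2.2
  have hRd := fun x (hx : x ∈ Ioo x₀ x₂) => h.hasDerivAt_R hn hγ hk hq hlam hx
  have hVc : ContinuousOn V (Ioo x₀ x₂) := fun x hx => (hVd x hx).continuousAt.continuousWithinAt
  have hCc : ContinuousOn C (Ioo x₀ x₂) := fun x hx => (hCd x hx).continuousAt.continuousWithinAt
  have hRc : ContinuousOn R (Ioo x₀ x₂) := fun x hx => (hRd x hx).continuousAt.continuousWithinAt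
  have hW : ∀ x ∈ Ioo x₀ x₂, 1 + V x ≠ 0 := fun x hx => (h.mem x hx).1.ne'
  have hx0 : ∀ x ∈ Ioo x₀ x₂, lam * x ≠ 0 := fun x hx => mul_ne_zero hlam (h.ne_zero hx)
  have hDc : ContinuousOn (fun x => D (V x) (C x)) (Ioo x₀ x₂) := by
    unfold D; fun_prop
  have hGc : ContinuousOn (fun x => G n γ κ lam (V x) (C x)) (Ioo x₀ x₂) := by
    unfold G; fun_prop
  have hFc : ContinuousOn (fun x => F n γ κ lam (V x) (C x)) (Ioo x₀ x₂) := by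
    unfold F
    have : ContinuousOn (fun x => alpha γ κ lam / (1 + V x)) (Ioo x₀ x₂) :=
      continuousOn_const.div (by fun_prop) hW
    fun_prop
  have hxc : ContinuousOn (fun x => -(1 / (lam * x))) (Ioo x₀ x₂) :=
    (continuousOn_const.div (by fun_prop) hx0).neg
  have hV'c := hxc.mul (hGc.div hDc fun x hx => (h.sol x hx).1)
  have hC'c := hxc.mul (hFc.div hDc fun x hx => (h.sol x hx).1)
  refine isRadialEulerFlow_of_profile_equations (by positivity) hlam h.nonpos hVd hCd hRd hV'c hC'c
    (hRc.mul ((hV'c.sub (ContinuousOn.div (by fun_prop) (by fun_prop) hx0)).neg.div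
      (by fun_prop) hW)) (fun x hx => (h.R_pos x hx).ne') ?_ ?_ ?_
  · intro x hx
    have := hW x hx
    field_simp
    ring
  · intro x hx
    have h1 := momentum_identity (κ := κ) hn hγ hlam (h.ne_zero hx) (hW x hx) (h.sol x hx).1
    rw [mul_div_cancel_left₀ _ (h.R_pos x hx).ne']
    exact h1
  · intro x hx
    exact energy_identity hn hγ hlam (h.ne_zero hx) (hW x hx) (h.sol x hx).1

/-- The adiabatic integral gives (R C²)^(γ−1−q) = (Z/W)^(γ−q) W^γ / (K x²). Here Z/W → s > 0, x → x₀
≠ 0 and W^γ → 0, while γ − 1 − q > 0 allows the root to be taken. -/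
theorem IsProfileAlong.tendsto_R_mul_C_sq {s : ℝ}
    (h : IsProfileAlong n γ κ lam z δ V C R K x₀ x₂) (hγ : 0 < γ)
    (hq : qExp n γ κ lam + 1 - γ < 0) (hz : Tendsto (fun W => z W / W) (𝓝[>] 0) (𝓝 s))
    (hs : 0 < s) : Tendsto (fun x => R x * C x ^ 2) (𝓝[>] x₀) (𝓝 0) := by
  set q := qExp n γ κ lam
  have hmem : ∀ᶠ x in 𝓝[>] x₀, x ∈ Ioo x₀ x₂ := Ioo_mem_nhdsGT h.lt
  have hx₀ : x₀ < 0 := h.lt.trans_le h.nonpos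
  have hW : Tendsto (fun x => 1 + V x) (𝓝[>] x₀) (𝓝[>] 0) := by
    refine tendsto_nhdsWithin_iff.2 ⟨?_, ?_⟩
    · simpa using h.V_start.const_add 1
    · filter_upwards [hmem] with x hx using (h.mem x hx).1
  have hWγ : Tendsto (fun x => (1 + V x) ^ γ) (𝓝[>] x₀) (𝓝 0) := by
    have := (Real.continuousAt_rpow_const 0 γ (Or.inr hγ.le)).tendsto
    rw [Real.zero_rpow hγ.ne'] at this
    exact this.comp (hW.mono_right nhdsWithin_le_nhds)
  have hZ : Tendsto (fun x => (z (1 + V x) / (1 + V x)) ^ (γ - q)) (𝓝[>] x₀)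
      (𝓝 (s ^ (γ - q))) :=
    (hz.comp hW).rpow_const (Or.inl hs.ne')
  have hx : Tendsto (fun x : ℝ => K * x ^ 2) (𝓝[>] x₀) (𝓝 (K * x₀ ^ 2)) :=
    ((by fun_prop : Continuous fun x : ℝ => K * x ^ 2).tendsto x₀).mono_left nhdsWithin_le_nhds
  have hKx : K * x₀ ^ 2 ≠ 0 := mul_ne_zero h.K_pos.ne' (pow_ne_zero _ hx₀.ne)
  have hlim := ((hZ.mul hWγ).div hx hKx).rpow_const (p := (γ - 1 - q)⁻¹)
    (Or.inr (inv_nonneg.2 (by linarith)))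
  rw [mul_zero, zero_div, Real.zero_rpow (inv_ne_zero (by linarith))] at hlim
  refine hlim.congr' ?_
  filter_upwards [hmem] with x hx
  have hC := h.C_pos x hx
  have hR := h.R_pos x hx
  have hW := (h.mem x hx).1
  have hx0 := h.ne_zero hx
  have hK := h.K_pos
  have hpow : (R x * C x ^ 2) ^ (γ - 1 - q) =
      (z (1 + V x) / (1 + V x)) ^ (γ - q) * (1 + V x) ^ γ / (K * x ^ 2) := by
    have h1 : R x ^ (γ - 1 - q) = C x ^ 2 * (1 + V x) ^ q / (K * x ^ 2) := by
      have : γ - 1 - q = -(q + 1 - γ) := by ring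
      rw [this, Real.rpow_neg hR.le, h.R_rpow hx, inv_div]
    have hC2 : 0 < C x ^ 2 := by positivity
    have h2 : (C x ^ 2) ^ (γ - q) = (C x ^ 2) ^ (γ - 1 - q) * C x ^ 2 := by
      rw [← Real.rpow_add_one hC2.ne']
      ring_nf
    have h3 : (1 + V x) ^ (γ - q) * (1 + V x) ^ q = (1 + V x) ^ γ := by
      rw [← Real.rpow_add hW]
      ring_nf
    have h4 := (Real.rpow_pos_of_pos hW (γ - q)).ne'
    rw [Real.mul_rpow hR.le hC2.le, h1, ← h.along x hx, Real.div_rpow hC2.le hW.le, h2, ← h3]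
    field_simp
  rw [Pi.div_apply, ← hpow, ← Real.rpow_mul (by positivity), mul_inv_cancel₀ (by linarith), Real.rpow_one]

theorem tendsto_similarity_interface (hlam : 0 < lam) (hx₀ : x₀ < 0) {t : ℝ} (ht : t < 0) :
    Tendsto (fun r : ℝ => t / r ^ lam) (𝓝[>] interfaceRadius lam x₀ t) (𝓝[>] x₀) := by
  have hpos : 0 < t / x₀ := div_pos_of_neg_of_neg ht hx₀
  have hr₀ : 0 < interfaceRadius lam x₀ t := Real.rpow_pos_of_pos hpos _
  have heq : t / interfaceRadius lam x₀ t ^ lam = x₀ := by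
    unfold interfaceRadius
    rw [← Real.rpow_mul hpos.le, one_div_mul_cancel hlam.ne', Real.rpow_one]
    field_simp [ht.ne, hx₀.ne]
  refine tendsto_nhdsWithin_iff.2 ⟨?_, ?_⟩
  · have := (hasDerivAt_similarity_r (lam := lam) (t := t) hr₀).continuousAt.tendsto
    rw [heq] at this
    exact this.mono_left nhdsWithin_le_nhds
  · filter_upwards [self_mem_nhdsWithin] with r hr
    have h1 := Real.rpow_lt_rpow hr₀.le hr hlam
    rw [mem_Ioi, ← heq]
    rw [div_eq_mul_inv, div_eq_mul_inv]
    exact mul_lt_mul_of_neg_left (inv_strictAnti₀ (Real.rpow_pos_of_pos hr₀ lam) h1) ht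

theorem IsProfileAlong.tendsto_pressure {s : ℝ}
    (h : IsProfileAlong n γ κ lam z δ V C R K x₀ x₂) (hγ : 0 < γ) (hlam : 0 < lam)
    (hq : qExp n γ κ lam + 1 - γ < 0) (hz : Tendsto (fun W => z W / W) (𝓝[>] 0) (𝓝 s))
    (hs : 0 < s) {t : ℝ} (ht : t < 0) :
    Tendsto (fun r => pressure γ (density κ lam R) (speed lam C) t r)
      (𝓝[>] interfaceRadius lam x₀ t) (𝓝 0) := by
  have hx₀ : x₀ < 0 := h.lt.trans_le h.nonpos
  have hr₀ : 0 < interfaceRadius lam x₀ t :=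
    Real.rpow_pos_of_pos (div_pos_of_neg_of_neg ht hx₀) _
  have hx := tendsto_similarity_interface hlam hx₀ ht
  have h1 := (h.tendsto_R_mul_C_sq hγ hq hz hs).comp hx
  have h2 : ∀ a : ℝ, Tendsto (fun r : ℝ => r ^ a) (𝓝[>] interfaceRadius lam x₀ t)
      (𝓝 (interfaceRadius lam x₀ t ^ a)) := fun a =>
    (Real.continuousAt_rpow_const _ a (Or.inl hr₀.ne')).tendsto.mono_left nhdsWithin_le_nhds
  have h3 := (((h2 κ).mul (((h2 (1 - lam)).div_const lam).pow 2)).mul h1).div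
    (((hx.mono_right nhdsWithin_le_nhds).pow 2).mul_const γ)
    (mul_ne_zero (pow_ne_zero 2 hx₀.ne) hγ.ne')
  rw [mul_zero, zero_div] at h3
  refine h3.congr fun r => ?_
  simp only [pressure, density, speed, Function.comp, Pi.div_apply]
  generalize C (t / r ^ lam) = c
  generalize t / r ^ lam = x
  rw [div_eq_mul_inv, mul_inv]
  ring

end Profile

end Cavity

theorem mainTheorem2 (n : ℕ) (γ κ lam : ℝ) (hγ : 1 < γ)
    (hA : 0 < lam - 1 ∧ lam - 1 < (κ + n) / 2)
    (hB : lam - 1 < n / 2 * (γ - 1)) :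
    0 < γ * (lam - 1) / (κ + n) ∧
    ∃ (Γ : ℝ → ℝ) (δ : ℝ),
      -- existence of the trajectory, in the open first quadrant
      Cavity.IsTrajectoryWithSlope n γ κ lam (γ * (lam - 1) / (κ + n)) Γ δ ∧
      (∀ W ∈ Set.Ioo 0 δ, 0 < Γ W) ∧
      -- uniqueness
      (∀ (z : ℝ → ℝ) (δ' : ℝ),
        Cavity.IsTrajectoryWithSlope n γ κ lam (γ * (lam - 1) / (κ + n)) z δ' →
          Set.EqOn z Γ (Set.Ioo 0 (min δ δ'))) ∧
      -- through each of its points there is a profile that reaches the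
      -- critical point at a finite value of the similarity variable
      (∀ K > 0, ∀ x₁ < 0, ∀ w ∈ Set.Ioo 0 δ, ∃ x₀ x₂ : ℝ, ∃ V C R : ℝ → ℝ,
        x₀ < x₁ ∧ x₁ < x₂ ∧ Cavity.IsProfileAlong n γ κ lam Γ δ V C R K x₀ x₂ ∧
          1 + V x₁ = w) ∧
      -- every such profile gives an Euler flow whose pressure vanishes at the interface
      (∀ (V C R : ℝ → ℝ) (K x₀ x₂ : ℝ), Cavity.IsProfileAlong n γ κ lam Γ δ V C R K x₀ x₂ →
        Cavity.IsRadialEulerFlow n γ (Cavity.density κ lam R) (Cavity.speed lam V)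
          (Cavity.speed lam C) (Cavity.fluidRegion lam x₀ x₂) ∧
        ∀ t < 0, Filter.Tendsto
          (fun r => Cavity.pressure γ (Cavity.density κ lam R) (Cavity.speed lam C) t r)
          (nhdsWithin (Cavity.interfaceRadius lam x₀ t)
            (Set.Ioi (Cavity.interfaceRadius lam x₀ t)))
          (nhds 0)) := by
  have hn := Cavity.natCast_pos_of_lt hA.1 hB
  have hk : 0 < κ + n := by linarith [hA.1, hA.2]
  have hlam : 0 < lam := by linarith [hA.1]
  have hq := Cavity.qExp_add_one_sub_neg hγ hA hB
  have hσ := Cavity.slope_pos hγ hA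
  obtain ⟨y, δ, _, hy, hpos, htraj, huniq⟩ := Cavity.exists_trajectory hγ hA hB
  refine ⟨hσ, fun W => W * y W, δ, htraj,
    fun W hW => mul_pos hW.1 (hpos W (Ioo_subset_Icc_self hW)).1, huniq,
    fun K hK x₁ hx₁ w hw => Cavity.exists_profile hγ hA hB hy hpos htraj hK hx₁ hw,
    fun V C R K x₀ x₂ h => ⟨h.isRadialEulerFlow hn hγ hk.ne' hq.ne hlam.ne',
      fun t ht => h.tendsto_pressure (by linarith) hlam hq htraj.slope hσ ht⟩⟩
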